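/- Let $X$ be a simply connected space whose rational cohomology $H^*(X;\mathbb{Q})$ is finite-dimensional, and let $N=\max\{k \mid H^k(X;\mathbb{Q})\neq 0\}$. Let $(\land V,d)$ be the Sullivan minimal model of $X$: a free graded commutative algebra over $\mathbb{Q}$ on a graded vector space $V=\bigoplus_{k\ge 2}V^k$, with a differential $d$ of degree $+1$ that takes values in the decomposable elements $\land^{\ge 2}V$, together with a quasi-isomorphism of differential graded algebras $(\land V,d)\to A_{PL}(X)$ to Sullivan's algebra of polynomial differential forms on $X$. Let $x\in V^{2n+1}$ be a Gottlieb element, that is, there is a linear map $\theta\colon\land V\to\land V$ lowering degrees by $2n+1$ such that $\theta(ab)=\theta(a)b+(-1)^{(2n+1)|a|}a\,\theta(b)$ for homogeneous $a$ and all $b$, $d\theta+\theta d=0$ and $\theta(x)=1$. Suppose that $dx$ is a monomial in the generators, that is, for some homogeneous basis of $V$, $dx$ is a rational multiple (possibly zero) of a product of elements of the basis. Then $2n+1<2N$. -/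

import Mathlib

open CategoryTheory Opposite DirectSum TensorProduct
open scoped Simplicial

universe u

noncomputable section

/-! ### Rational singular cohomology -/

/-- The cosimplicial rational vector space `[n] ↦ (K_n → ℚ)` of a simplicial set `K`. -/
def ratCosimplicial (K : SSet.{u}) : CosimplicialObject (ModuleCat.{u} ℚ) where
  obj n := ModuleCat.of ℚ (K.obj (op n) → ℚ)
  map α := ModuleCat.ofHom (LinearMap.funLeft ℚ ℚ (K.map α.op))
  map_id n := by
    ext f σ
    simp [LinearMap.funLeft]
  map_comp α β := by
    ext f σ
    simp [LinearMap.funLeft]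

/-- The singular cochain complex `C^*(X; ℚ)`: in degree `n` all functions from singular
`n`-simplices to `ℚ`, with differential `(δf)(σ) = ∑ i, (-1)^i f(∂_i σ)`. -/
def singularCochains (X : TopCat.{u}) : CochainComplex (ModuleCat.{u} ℚ) ℕ :=
  (AlgebraicTopology.alternatingCofaceMapComplex (ModuleCat.{u} ℚ)).obj
    (ratCosimplicial (TopCat.toSSet.obj X))

/-- The singular cohomology `H^n(X; ℚ)`. -/
abbrev ratCohomology (X : TopCat.{u}) (n : ℕ) : ModuleCat.{u} ℚ :=
  (singularCochains X).homology n

/-! ### Polynomial differential forms on simplices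

The coordinate ring of the `n`-simplex is `ℚ[t_0, …, t_n]/(t_0 + ⋯ + t_n - 1)`, written as the
polynomial ring on `t_1, …, t_n` (the variable `X i` is `t_{i+1}`). The tangent space of the
simplex is `ℚ^n`, with the coordinates `dt_1, …, dt_n`. -/

/-- The barycentric coordinate functions `t_0, …, t_n` on the `n`-simplex. -/
def baryCoord (n : ℕ) : Fin (n + 1) → MvPolynomial (Fin n) ℚ :=
  Fin.cons (1 - ∑ i, MvPolynomial.X i) MvPolynomial.X

/-- The barycentric components `dt_0(v), …, dt_n(v)` of a tangent vector `v`. -/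
def baryTangent (n : ℕ) (v : Fin n → ℚ) : Fin (n + 1) → ℚ :=
  Fin.cons (-∑ i, v i) v

/-- The pullback of polynomial functions along the affine map of simplices given on vertices
by `α`: it sends `t_j` to the sum of the `t_i` with `α i = j`. -/
def pullPoly {m n : ℕ} (α : Fin (m + 1) → Fin (n + 1)) :
    MvPolynomial (Fin n) ℚ →ₐ[ℚ] MvPolynomial (Fin m) ℚ :=
  MvPolynomial.aeval fun j : Fin n => ∑ i with α i = j.succ, baryCoord m i

/-- The differential of the affine map of simplices given on vertices by `α`. -/
def pushTangent {m n : ℕ} (α : Fin (m + 1) → Fin (n + 1)) : (Fin m → ℚ) →ₗ[ℚ] (Fin n → ℚ) where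
  toFun v j := ∑ i with α i = j.succ, baryTangent m v i
  map_add' v w := by
    funext j
    rw [Pi.add_apply, ← Finset.sum_add_distrib]
    refine Finset.sum_congr rfl fun i _ => ?_
    refine Fin.cases ?_ (fun k => ?_) i
    · simp [baryTangent, Finset.sum_add_distrib]; ring
    · simp [baryTangent]
  map_smul' c v := by
    funext j
    rw [Pi.smul_apply, Finset.smul_sum]
    refine Finset.sum_congr rfl fun i _ => ?_
    refine Fin.cases ?_ (fun k => ?_) i
    · simp [baryTangent, Finset.mul_sum]
    · simp [baryTangent]

/-- Polynomial differential `q`-forms with rational coefficients on the `n`-simplex: alternating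
`q`-forms on the tangent space, with values in the polynomial functions. -/
abbrev PolyForm (n q : ℕ) : Type :=
  (Fin n → ℚ) [⋀^Fin q]→ₗ[ℚ] MvPolynomial (Fin n) ℚ

namespace PolyForm

/-- The pullback of forms along the affine map of simplices given on vertices by `α`. -/
def pullback {m n : ℕ} (α : Fin (m + 1) → Fin (n + 1)) (q : ℕ) : PolyForm n q →ₗ[ℚ] PolyForm m q where
  toFun ω := (pullPoly α).toLinearMap.compAlternatingMap (ω.compLinearMap (pushTangent α))
  map_add' ω η := by ext v; simp
  map_smul' c ω := by ext v; simp

/-- The derivative of polynomial functions in the direction of a constant vector field. -/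
def dirDeriv (n : ℕ) :
    (Fin n → ℚ) →ₗ[ℚ] MvPolynomial (Fin n) ℚ →ₗ[ℚ] MvPolynomial (Fin n) ℚ :=
  ∑ i, (LinearMap.proj i : (Fin n → ℚ) →ₗ[ℚ] ℚ).smulRight (MvPolynomial.pderiv i).toLinearMap

/-- The derivative of the coefficients of a form in the direction of a constant vector field. -/
def formDeriv {n q : ℕ} (ω : PolyForm n q) : (Fin n → ℚ) →ₗ[ℚ] PolyForm n q where
  toFun v := (dirDeriv n v).compAlternatingMap ω
  map_add' v w := by ext u; simp
  map_smul' c v := by ext u; simp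

/-- The exterior derivative
`(dω)(v_0, …, v_q) = ∑ i, (-1)^i ∂_{v_i} (ω(v_0, …, v_{i-1}, v_{i+1}, …, v_q))`. -/
def d {n : ℕ} (q : ℕ) : PolyForm n q →ₗ[ℚ] PolyForm n (q + 1) where
  toFun ω := AlternatingMap.alternatizeUncurryFin (formDeriv ω)
  map_add' ω η := by
    rw [← AlternatingMap.alternatizeUncurryFin_add]
    congr 1
    ext v u
    simp [formDeriv]
  map_smul' c ω := by
    rw [RingHom.id_apply, ← AlternatingMap.alternatizeUncurryFin_smul]
    congr 1
    ext v u
    simp [formDeriv]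

/-- The exterior product, by the sum over `(p, q)`-shuffles. -/
def wedge {n p q : ℕ} (ω : PolyForm n p) (η : PolyForm n q) : PolyForm n (p + q) :=
  ((LinearMap.mul' ℚ (MvPolynomial (Fin n) ℚ)).compAlternatingMap
    (ω.domCoprod η)).domDomCongr finSumFinEquiv

theorem dirDeriv_apply {n : ℕ} (v : Fin n → ℚ) (f : MvPolynomial (Fin n) ℚ) :
    dirDeriv n v f = ∑ i, v i • MvPolynomial.pderiv i f := by
  simp [dirDeriv, LinearMap.sum_apply]

theorem dirDeriv_comm {n : ℕ} (v w : Fin n → ℚ) (f : MvPolynomial (Fin n) ℚ) :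
    dirDeriv n v (dirDeriv n w f) = dirDeriv n w (dirDeriv n v f) := by
  simp only [dirDeriv_apply, map_sum, map_smul, Finset.smul_sum]
  rw [Finset.sum_comm]
  refine Finset.sum_congr rfl fun i _ => Finset.sum_congr rfl fun j _ => ?_
  let D (k : Fin n) : Derivation ℚ (MvPolynomial (Fin n) ℚ) (MvPolynomial (Fin n) ℚ) :=
    MvPolynomial.pderiv k
  have h : ⁅D j, D i⁆ = 0 := by
    refine MvPolynomial.derivation_ext fun k => ?_
    simp [D, Derivation.commutator_apply, MvPolynomial.pderiv_X, Pi.single_apply, apply_ite]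
  have h' := congrArg (fun D => D f) h
  simp only [D, Derivation.commutator_apply, Derivation.zero_apply, sub_eq_zero] at h'
  rw [smul_comm, h']

theorem d_d {n q : ℕ} (ω : PolyForm n q) : d (q + 1) (d q ω) = 0 := by
  ext v
  have h := AlternatingMap.alternatizeUncurryFin_alternatizeUncurryFinLM_comp_of_symmetric
    (R := ℚ) (f := LinearMap.mk₂ ℚ (fun u w => (dirDeriv n u).compAlternatingMap (formDeriv ω w))
      (by intros; ext; simp) (by intros; ext; simp) (by intros; ext; simp [formDeriv])
      (by intros; ext; simp [formDeriv])) (by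
        intro u w
        ext y
        simp [formDeriv, dirDeriv_comm u w])
  rw [← h]
  have hs : ∀ (u : Fin n → ℚ) (k : ℕ) (g : MvPolynomial (Fin n) ℚ),
      dirDeriv n u ((-1) ^ k * g) = (-1) ^ k * dirDeriv n u g := by
    intro u k g
    rcases neg_one_pow_eq_or (MvPolynomial (Fin n) ℚ) k with h | h <;> simp [h]
  simp [d, AlternatingMap.alternatizeUncurryFin_apply, formDeriv, hs]

theorem dirDeriv_pullPoly {m n : ℕ} (α : Fin (m + 1) → Fin (n + 1)) (v : Fin m → ℚ)
    (f : MvPolynomial (Fin n) ℚ) :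
    dirDeriv m v (pullPoly α f) = pullPoly α (dirDeriv n (pushTangent α v) f) := by
  have hb : ∀ i, dirDeriv m v (baryCoord m i) = MvPolynomial.C (baryTangent m v i) := by
    intro i
    refine Fin.cases ?_ (fun k => ?_) i <;>
      simp [dirDeriv_apply, baryCoord, baryTangent, MvPolynomial.pderiv_X, Pi.single_apply,
        MvPolynomial.smul_eq_C_mul]
  induction f using MvPolynomial.induction_on with
  | C a => simp [dirDeriv_apply, pullPoly]
  | add p q hp hq => simp only [map_add, hp, hq]
  | mul_X p j hp =>
    have hl : ∀ (k : ℕ) (u : Fin k → ℚ) (g h : MvPolynomial (Fin k) ℚ),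
        dirDeriv k u (g * h) = g * dirDeriv k u h + h * dirDeriv k u g := by
      intro k u g h
      simp [dirDeriv_apply, Finset.mul_sum, Finset.sum_add_distrib]
    have hX : dirDeriv m v (pullPoly α (MvPolynomial.X j)) =
        pullPoly α (dirDeriv n (pushTangent α v) (MvPolynomial.X j)) := by
      have h1 : dirDeriv n (pushTangent α v) (MvPolynomial.X j) =
          MvPolynomial.C (pushTangent α v j) := by
        simp [dirDeriv_apply, MvPolynomial.pderiv_X, Pi.single_apply, MvPolynomial.smul_eq_C_mul]
      rw [h1]
      simp [pullPoly, pushTangent, hb]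
    rw [map_mul, hl, hl, hp, hX]
    simp only [map_add, map_mul]

theorem d_pullback {m n q : ℕ} (α : Fin (m + 1) → Fin (n + 1)) (ω : PolyForm n q) :
    d q (pullback α q ω) = pullback α (q + 1) (d q ω) := by
  ext1 v
  simp [d, pullback, AlternatingMap.alternatizeUncurryFin_apply, formDeriv, dirDeriv_pullPoly]
  rfl

end PolyForm

/-! ### The algebra of polynomial forms of a space -/

/-- Polynomial `q`-forms on a simplicial set: a form on every simplex, compatibly with all face
and degeneracy maps. -/
def SSet.polyForms (K : SSet.{u}) (q : ℕ) : Submodule ℚ (∀ n : ℕ, K _⦋n⦌ → PolyForm n q) where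
  carrier := {Φ | ∀ (m n : ℕ) (α : ⦋m⦌ ⟶ ⦋n⦌) (σ : K _⦋n⦌),
    Φ m (K.map α.op σ) = PolyForm.pullback (SimplexCategory.Hom.toOrderHom α) q (Φ n σ)}
  add_mem' h h' m n α σ := by simp [h m n α σ, h' m n α σ]
  zero_mem' m n α σ := by simp
  smul_mem' c Φ h m n α σ := by simp [h m n α σ]

/-- The exterior derivative, simplex by simplex. -/
def SSet.polyFormsD (K : SSet.{u}) (q : ℕ) : K.polyForms q →ₗ[ℚ] K.polyForms (q + 1) where
  toFun Φ := ⟨fun n σ => PolyForm.d q (Φ.1 n σ), fun m n α σ => by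
    change PolyForm.d q (Φ.1 m _) = _
    rw [Φ.2 m n α σ, PolyForm.d_pullback]⟩
  map_add' Φ Ψ := by ext1; funext n σ; simp
  map_smul' c Φ := by ext1; funext n σ; simp

/-- Sullivan's cochain algebra `A_PL(X)` of polynomial forms, as a cochain complex. -/
def APL (X : TopCat.{u}) : CochainComplex (ModuleCat.{u} ℚ) ℕ :=
  CochainComplex.of (fun q => ModuleCat.of ℚ ((TopCat.toSSet.obj X).polyForms q))
    (fun q => ModuleCat.ofHom ((TopCat.toSSet.obj X).polyFormsD q)) (fun q => by
      refine ModuleCat.hom_ext (LinearMap.ext fun Φ => Subtype.ext ?_)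
      funext n σ
      exact PolyForm.d_d _)

/-- The form on the `n`-simplex `σ` given by an element of `A_PL(X)`. -/
def APL.on {X : TopCat.{u}} {q : ℕ} (Φ : (APL X).X q) (n : ℕ)
    (σ : (TopCat.toSSet.obj X) _⦋n⦌) : PolyForm n q :=
  (show (TopCat.toSSet.obj X).polyForms q from Φ).1 n σ

/-! ### Free graded commutative algebras -/

section FreeGC

variable (V : ℕ → Type u) [∀ k, AddCommGroup (V k)] [∀ k, Module ℚ (V k)]

/-- The graded commutativity relations `v w = (-1)^{|v||w|} w v` in the tensor algebra. -/
inductive FreeGCRel : TensorAlgebra ℚ (⨁ k, V k) → TensorAlgebra ℚ (⨁ k, V k) → Prop where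
  | comm {p q : ℕ} (v : V p) (w : V q) : FreeGCRel
      (TensorAlgebra.ι ℚ (lof ℚ ℕ V p v) * TensorAlgebra.ι ℚ (lof ℚ ℕ V q w))
      ((-1 : ℚ) ^ (p * q) •
        (TensorAlgebra.ι ℚ (lof ℚ ℕ V q w) * TensorAlgebra.ι ℚ (lof ℚ ℕ V p v)))

/-- The free graded commutative algebra `ΛV` on the graded rational vector space `V`. -/
abbrev FreeGC : Type u := RingQuot (FreeGCRel V)

namespace FreeGC

/-- The inclusion of `V^k` into `ΛV`. -/
def gen (k : ℕ) : V k →ₗ[ℚ] FreeGC V :=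
  (RingQuot.mkAlgHom ℚ (FreeGCRel V)).toLinearMap ∘ₗ TensorAlgebra.ι ℚ ∘ₗ lof ℚ ℕ V k

/-- The product in `ΛV` of a list of homogeneous elements of `V`. -/
def word (l : List (Σ k, V k)) : FreeGC V := (l.map fun s => gen V s.1 s.2).prod

/-- The part `(ΛV)^n` of degree `n`, spanned by the products of homogeneous elements of `V` of
total degree `n`. -/
def gr (n : ℕ) : Submodule ℚ (FreeGC V) :=
  Submodule.span ℚ {z | ∃ l : List (Σ k, V k), (l.map Sigma.fst).sum = n ∧ z = word V l}

/-- The decomposable elements `Λ^{≥ 2} V`, spanned by the products of at least two homogeneous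
elements of `V`. -/
def decomposables : Submodule ℚ (FreeGC V) :=
  Submodule.span ℚ {z | ∃ l : List (Σ k, V k), 2 ≤ l.length ∧ z = word V l}

theorem one_mem_gr : (1 : FreeGC V) ∈ gr V 0 :=
  Submodule.subset_span ⟨[], by simp, by simp [word]⟩

theorem mul_mem_gr {p q : ℕ} {a b : FreeGC V} (ha : a ∈ gr V p) (hb : b ∈ gr V q) :
    a * b ∈ gr V (p + q) := by
  have h : gr V p * gr V q ≤ gr V (p + q) := by
    rw [gr, gr, Submodule.span_mul_span]
    refine Submodule.span_le.2 ?_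
    rintro _ ⟨_, ⟨l, hl, rfl⟩, _, ⟨l', hl', rfl⟩, rfl⟩
    exact Submodule.subset_span ⟨l ++ l', by simp [hl, hl'], by simp [word]⟩
  exact h (Submodule.mul_mem_mul ha hb)

/-- `z` is a monomial (with a rational coefficient) in the elements of the homogeneous basis `b`
of `V`. -/
def IsMonomial {ι : ℕ → Type*} (b : ∀ k, Module.Basis (ι k) ℚ (V k)) (z : FreeGC V) : Prop :=
  ∃ (c : ℚ) (l : List (Σ k, ι k)), z = c • word V (l.map fun s => ⟨s.1, b s.1 s.2⟩)

end FreeGC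

/-! ### Sullivan minimal models and Gottlieb elements -/

/-- A simply connected minimal Sullivan algebra `(ΛV, d)` over `ℚ`: the generators have degrees
`≥ 2` and the differential takes values in the decomposable elements. -/
structure MinimalSullivanAlgebra where
  subsingleton_zero : Subsingleton (V 0)
  subsingleton_one : Subsingleton (V 1)
  d : FreeGC V →ₗ[ℚ] FreeGC V
  d_mem : ∀ (n : ℕ) (a : FreeGC V), a ∈ FreeGC.gr V n → d a ∈ FreeGC.gr V (n + 1)
  d_mul : ∀ (n : ℕ) (a b : FreeGC V), a ∈ FreeGC.gr V n →
    d (a * b) = d a * b + (-1 : ℚ) ^ n • (a * d b)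
  d_d : ∀ a, d (d a) = 0
  d_decomposable : ∀ a, d a ∈ FreeGC.decomposables V

variable {V}

namespace MinimalSullivanAlgebra

/-- The underlying cochain complex of `(ΛV, d)`. -/
def complex (A : MinimalSullivanAlgebra V) : CochainComplex (ModuleCat.{u} ℚ) ℕ :=
  CochainComplex.of (fun n => ModuleCat.of ℚ (FreeGC.gr V n))
    (fun n => ModuleCat.ofHom (A.d.restrict (A.d_mem n))) (fun n => by
      exact ModuleCat.hom_ext (LinearMap.ext fun a => Subtype.ext (A.d_d a.1)))

/-- A homogeneous element of `ΛV`, as an element of the underlying cochain complex. -/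
def toComplex (A : MinimalSullivanAlgebra V) {n : ℕ} (a : FreeGC V) (ha : a ∈ FreeGC.gr V n) :
    A.complex.X n :=
  show FreeGC.gr V n from ⟨a, ha⟩

/-- `(ΛV, d)` with the morphism `φ` is a Sullivan minimal model of the space `X`: `φ` is a
morphism of graded algebras `(ΛV, d) → A_PL(X)` compatible with the differentials, and a
quasi-isomorphism. -/
structure IsModel (A : MinimalSullivanAlgebra V) (X : TopCat.{u}) (φ : A.complex ⟶ APL X) :
    Prop where
  map_one : ∀ n σ, APL.on (φ.f 0 (A.toComplex 1 (FreeGC.one_mem_gr V))) n σ =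
    AlternatingMap.constOfIsEmpty ℚ (Fin n → ℚ) (Fin 0) (1 : MvPolynomial (Fin n) ℚ)
  map_mul : ∀ (p q : ℕ) (a b : FreeGC V) (ha : a ∈ FreeGC.gr V p) (hb : b ∈ FreeGC.gr V q) n σ,
    APL.on (φ.f (p + q) (A.toComplex (a * b) (FreeGC.mul_mem_gr V ha hb))) n σ =
      (APL.on (φ.f p (A.toComplex a ha)) n σ).wedge (APL.on (φ.f q (A.toComplex b hb)) n σ)
  quasiIso : QuasiIso φ

/-- `θ` is a derivation of `ΛV` of degree `m`, that is, one that lowers degrees by `m`. -/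
structure IsDerivation (m : ℕ) (θ : FreeGC V →ₗ[ℚ] FreeGC V) : Prop where
  lowers : ∀ (k : ℕ) (a : FreeGC V), a ∈ FreeGC.gr V (k + m) → θ a ∈ FreeGC.gr V k
  eq_zero : ∀ (k : ℕ) (a : FreeGC V), k < m → a ∈ FreeGC.gr V k → θ a = 0
  leibniz : ∀ (k : ℕ) (a b : FreeGC V), a ∈ FreeGC.gr V k →
    θ (a * b) = θ a * b + (-1 : ℚ) ^ (k * m) • (a * θ b)

/-- `v ∈ V^m` is a Gottlieb element of `(ΛV, d)`: there is a derivation `θ` of degree `m` that is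
a cycle, `d θ - (-1)^m θ d = 0`, and satisfies `θ(v) = 1`. -/
def IsGottlieb (A : MinimalSullivanAlgebra V) {m : ℕ} (v : V m) : Prop :=
  ∃ θ : FreeGC V →ₗ[ℚ] FreeGC V, IsDerivation m θ ∧
    (∀ a, A.d (θ a) - (-1 : ℚ) ^ m • θ (A.d a) = 0) ∧ θ (FreeGC.gen V m v) = 1

end MinimalSullivanAlgebra

end FreeGC

end

/-! Suppose $N\le n$. The cohomology of $(\land V,d)$ vanishes in every degree above $N$, so every
cocycle there is exact, and by minimality it is then decomposable. A nonzero generator is never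
decomposable. Hence $dx=0$ is impossible, and $dx$ is a nonzero multiple of a monomial $yQ$, where
$y$ is chosen as a letter of least degree. Since $V^1=0$ and $d$ is decomposable, $dy$ involves only
generators of degree below $|y|$, and such elements are not annihilated by the nonzero monomials in
letters of degree at least $|y|$ (`eq_zero_of_mul_bword_eq_zero`). Combined with $d(yQ)=0$ this
forces $dy=0$.

If $|y|$ is odd, $yx$ is a cocycle because $y^2=0$, so $yx=dw$. Applying $\theta$, which kills $y$
for degree reasons, gives $-y=\theta dw=-d\theta w$, so $y$ is decomposable, a contradiction. If
$|y|$ is even, also $dQ=0$, since $y$ is a nonzerodivisor. As $|y|\le|Q|$ and $|y|+|Q|=2n+2$, one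
has $|Q|\ge n+1>N$, so $Q=dw$. Then $x-e\,yw$, with $e$ the coefficient of $dx$, is a cocycle, hence
decomposable; as $yw$ is decomposable too, so is $x$, a contradiction. This is
`degree_lt_of_isGottlieb`.

The vanishing must be carried from singular cohomology to $A_{PL}(X)$, and from there along the
quasi-isomorphism. The first step is the vanishing part of the simplicial de Rham theorem
(`APL.exactAt`). It is a zigzag in a double complex of natural families of alternating $r$-forms on
the vertices with values in polynomial $q$-forms. The vertex direction is contracted by the
barycentric partition of unity (`vertexH`), the form direction for $r\ge1$ by averaged cones to the
vertices (`formH`). The corner $q=0$ consists, after taking closed forms, of alternating cochains,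
which are compared with singular cochains through normalization. -/

noncomputable section

/-! ### Free graded commutative algebras: degrees and linear parts. -/

namespace FreeGC

variable {V : ℕ → Type u} [∀ k, AddCommGroup (V k)] [∀ k, Module ℚ (V k)]

/-- The universal property of the free graded commutative algebra. -/
def lift {B : Type*} [Ring B] [Algebra ℚ B] (f : ∀ k, V k →ₗ[ℚ] B)
    (hf : ∀ (p q : ℕ) (v : V p) (w : V q),
      f p v * f q w = (-1 : ℚ) ^ (p * q) • (f q w * f p v)) : FreeGC V →ₐ[ℚ] B :=
  RingQuot.liftAlgHom ℚ ⟨TensorAlgebra.lift ℚ (DirectSum.toModule ℚ ℕ B f), by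
    rintro _ _ ⟨v, w⟩
    rw [map_mul, map_smul, map_mul]
    simp only [TensorAlgebra.lift_ι_apply, DirectSum.toModule_lof]
    exact hf _ _ v w⟩

theorem lift_gen {B : Type*} [Ring B] [Algebra ℚ B] (f : ∀ k, V k →ₗ[ℚ] B)
    (hf : ∀ (p q : ℕ) (v : V p) (w : V q),
      f p v * f q w = (-1 : ℚ) ^ (p * q) • (f q w * f p v)) (k : ℕ) (v : V k) :
    lift f hf (gen V k v) = f k v := by
  simp [lift, gen, DirectSum.toModule_lof]

theorem gen_mul_gen {p q : ℕ} (v : V p) (w : V q) :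
    gen V p v * gen V q w = (-1 : ℚ) ^ (p * q) • (gen V q w * gen V p v) := by
  have h := RingQuot.mkAlgHom_rel ℚ (FreeGCRel.comm v w)
  simpa [gen] using h

theorem induction {P : FreeGC V → Prop} (one : P 1) (add : ∀ a b, P a → P b → P (a + b))
    (smul : ∀ (c : ℚ) a, P a → P (c • a))
    (gen_mul : ∀ k (v : V k) a, P a → P (gen V k v * a)) (a : FreeGC V) : P a := by
  obtain ⟨t, rfl⟩ := RingQuot.mkAlgHom_surjective ℚ (FreeGCRel V) a
  -- Stated for left multiplication by `t`, the claim passes to products in the tensor algebra by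
  -- composition.
  suffices h : ∀ a, P a → P (RingQuot.mkAlgHom ℚ (FreeGCRel V) t * a) by
    simpa using h 1 one
  induction t using TensorAlgebra.induction with
  | algebraMap r =>
    intro a ha
    rw [AlgHom.commutes, ← Algebra.smul_def]
    exact smul r a ha
  | ι x =>
    intro a ha
    induction x using DirectSum.induction_on with
    | zero => simpa using smul 0 a ha
    | of k v => exact gen_mul k v a ha
    | add x y hx hy =>
      rw [map_add, map_add, add_mul]
      exact add _ _ hx hy
  | mul s t hs ht =>
    intro a ha
    rw [map_mul, mul_assoc]
    exact hs _ (ht _ ha)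
  | add s t hs ht =>
    intro a ha
    rw [map_add, add_mul]
    exact add _ _ (hs _ ha) (ht _ ha)

theorem word_nil : word V [] = 1 := by simp [word]

theorem word_cons (s : Σ k, V k) (l : List (Σ k, V k)) :
    word V (s :: l) = gen V s.1 s.2 * word V l := by simp [word]

theorem word_append (l l' : List (Σ k, V k)) :
    word V (l ++ l') = word V l * word V l' := by simp [word]

theorem word_mem_gr (l : List (Σ k, V k)) : word V l ∈ gr V (l.map Sigma.fst).sum :=
  Submodule.subset_span ⟨l, rfl, rfl⟩

theorem gen_mem_gr {k : ℕ} (v : V k) : gen V k v ∈ gr V k :=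
  Submodule.subset_span ⟨[⟨k, v⟩], by simp, by simp [word]⟩

theorem commute_gen_of_even {p : ℕ} (hp : Even p) (y : V p) (a : FreeGC V) :
    Commute (gen V p y) a := by
  induction a using FreeGC.induction with
  | one => exact Commute.one_right _
  | add a b ha hb => exact ha.add_right hb
  | smul c a ha => exact ha.smul_right c
  | gen_mul k v a ha =>
    refine Commute.mul_right ?_ ha
    rw [Commute, SemiconjBy, gen_mul_gen, (hp.mul_right k).neg_one_pow, one_smul]

theorem neg_one_smul_eq (a : FreeGC V) : (-1 : ℚ) • a = -a := by
  have h := neg_smul (1 : ℚ) a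
  rwa [one_smul] at h

theorem gen_mul_self_of_odd {p : ℕ} (hp : Odd p) (y : V p) : gen V p y * gen V p y = 0 := by
  have h := gen_mul_gen y y
  rw [(hp.mul hp).neg_one_pow, neg_one_smul_eq] at h
  have h2 : (2 : ℚ) • (gen V p y * gen V p y) = 0 := by
    rw [two_smul]; nth_rewrite 1 [h]; simp
  exact (smul_eq_zero.1 h2).resolve_left two_ne_zero

theorem exists_word_eq_smul_of_perm {l l' : List (Σ k, V k)} (h : l.Perm l') :
    ∃ c : ℚ, word V l = c • word V l' := by
  induction h with
  | nil => exact ⟨1, by simp⟩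
  | cons s _ ih =>
    obtain ⟨c, hc⟩ := ih
    exact ⟨c, by rw [word_cons, word_cons, hc, mul_smul_comm]⟩
  | swap s t l =>
    refine ⟨(-1) ^ (t.1 * s.1), ?_⟩
    simp only [word_cons, ← mul_assoc]
    rw [gen_mul_gen, smul_mul_assoc]
  | trans _ _ ih ih' =>
    obtain ⟨c, hc⟩ := ih
    obtain ⟨c', hc'⟩ := ih'
    exact ⟨c * c', by rw [hc, hc', mul_smul]⟩

/-- The algebra map recording degrees by powers of a variable. -/
def degreeHom : FreeGC V →ₐ[ℚ] Polynomial (FreeGC V) :=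
  lift (B := Polynomial (FreeGC V)) (fun k =>
    { toFun v := Polynomial.monomial k (gen V k v)
      map_add' v w := by rw [map_add, map_add]
      map_smul' c v := by rw [map_smul, RingHom.id_apply, Polynomial.smul_monomial] }) (by
    intro p q v w
    change Polynomial.monomial p _ * Polynomial.monomial q _ =
      _ • (Polynomial.monomial q _ * Polynomial.monomial p _)
    rw [Polynomial.monomial_mul_monomial, Polynomial.monomial_mul_monomial, gen_mul_gen v w,
      add_comm q p, Polynomial.smul_monomial])

/-- The relations are homogeneous, so the degree can be stored as an exponent. This makes the spans
`gr V n` independent without any basis of the quotient algebra. -/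
theorem degreeHom_of_mem {n : ℕ} {a : FreeGC V} (ha : a ∈ gr V n) :
    degreeHom a = Polynomial.monomial n a := by
  have hw : ∀ l : List (Σ k, V k),
      degreeHom (word V l) = Polynomial.monomial (l.map Sigma.fst).sum (word V l) := by
    intro l
    induction l with
    | nil => simp [word_nil]
    | cons s l ih =>
      rw [word_cons, map_mul, ih, degreeHom, lift_gen]
      change Polynomial.monomial _ _ * _ = _
      rw [Polynomial.monomial_mul_monomial, List.map_cons, List.sum_cons]
  induction ha using Submodule.span_induction with
  | mem z hz => obtain ⟨l, rfl, rfl⟩ := hz; exact hw l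
  | zero => simp
  | add a b _ _ ha hb => rw [map_add, ha, hb, map_add]
  | smul c a _ ha => rw [map_smul, ha, Polynomial.smul_monomial]

theorem eq_of_mem_gr {p q : ℕ} {a : FreeGC V} (hp : a ∈ gr V p) (hq : a ∈ gr V q) (ha : a ≠ 0) :
    p = q := by
  have h := (degreeHom_of_mem hp).symm.trans (degreeHom_of_mem hq)
  by_contra hpq
  have h' := congrArg (fun f => Polynomial.coeff f p) h
  simp [Polynomial.coeff_monomial, Ne.symm hpq] at h'
  exact ha h'

/-- The algebra map to the dual numbers extending linear forms on the generators. -/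
def linearHom (f : ∀ k, V k →ₗ[ℚ] ℚ) : FreeGC V →ₐ[ℚ] DualNumber ℚ :=
  lift (fun k => TrivSqZeroExt.inrHom ℚ ℚ ∘ₗ f k) (by intro p q v w; simp)

/-- Two factors already give $\varepsilon^2=0$. Thus `linearHom` detects constants and linear parts
modulo decomposables. -/
theorem linearHom_word (f : ∀ k, V k →ₗ[ℚ] ℚ) (l : List (Σ k, V k)) (hl : 2 ≤ l.length) :
    linearHom f (word V l) = 0 := by
  match l, hl with
  | s :: t :: l, _ =>
    rw [word_cons, word_cons, ← mul_assoc, map_mul, map_mul, linearHom, lift_gen, lift_gen]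
    simp

theorem linearHom_of_mem_decomposables (f : ∀ k, V k →ₗ[ℚ] ℚ) {a : FreeGC V}
    (ha : a ∈ decomposables V) : linearHom f a = 0 := by
  induction ha using Submodule.span_induction with
  | mem z hz => obtain ⟨l, hl, rfl⟩ := hz; exact linearHom_word f l hl
  | zero => simp
  | add a b _ _ ha hb => rw [map_add, ha, hb, add_zero]
  | smul c a _ ha => rw [map_smul, ha, smul_zero]

instance : Nontrivial (FreeGC V) := (linearHom (V := V) fun _ => 0).toRingHom.domain_nontrivial

theorem smul_one_notMem_decomposables {c : ℚ} (hc : c ≠ 0) :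
    c • (1 : FreeGC V) ∉ decomposables V := fun h => by
  have h' := linearHom_of_mem_decomposables (fun _ => 0) h
  rw [map_smul, map_one] at h'
  exact (smul_eq_zero.1 h').elim hc one_ne_zero

theorem eq_zero_of_gen_mem_decomposables {k : ℕ} {v : V k} (h : gen V k v ∈ decomposables V) :
    v = 0 := by
  rw [← Module.forall_dual_apply_eq_zero_iff ℚ]
  intro g
  have h' := linearHom_of_mem_decomposables
    (fun j => if h : j = k then h ▸ g else 0 : ∀ j, V j →ₗ[ℚ] ℚ) h
  rw [linearHom, lift_gen] at h'
  simpa using congrArg TrivSqZeroExt.snd h'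

/-- The dual basis of a homogeneous basis, extended by zero to the other degrees. -/
def coordForm {ι : ℕ → Type*} (b : ∀ k, Module.Basis (ι k) ℚ (V k)) (z : Σ k, ι k) (k : ℕ) :
    V k →ₗ[ℚ] ℚ :=
  if h : z.1 = k then (b k).coord (h ▸ z.2) else 0

section Basis

variable {ι : ℕ → Type*} (b : ∀ k, Module.Basis (ι k) ℚ (V k))

/-- The element of a homogeneous basis with a given index, as a homogeneous element. -/
def basisElt (z : Σ k, ι k) : Σ k, V k := ⟨z.1, b z.1 z.2⟩

theorem coordForm_of_ne {z : Σ k, ι k} {k : ℕ} (h : z.1 ≠ k) : coordForm b z k = 0 := by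
  rw [coordForm, dif_neg h]

theorem coordForm_self (z : Σ k, ι k) : coordForm b z z.1 (b z.1 z.2) = 1 := by
  simp [coordForm]

theorem coordForm_basis_of_ne {z w : Σ k, ι k} (h : z ≠ w) : coordForm b z w.1 (b w.1 w.2) = 0 := by
  obtain ⟨k, i⟩ := z
  obtain ⟨k', j⟩ := w
  by_cases hk : k = k'
  · subst hk
    have hij : j ≠ i := fun h' => h (by rw [h'])
    simp [coordForm, hij]
  · rw [coordForm_of_ne b hk, LinearMap.zero_apply]

end Basis

end FreeGC

/-! ### Graded partial derivatives and regularity of monomials. -/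

namespace FreeGC

variable {V : ℕ → Type u} [∀ k, AddCommGroup (V k)] [∀ k, Module ℚ (V k)]

/-- The value on a generator of the algebra map `a ↦ !![± a, ∂ a; 0, a]`. -/
def pderivGen (s : ℕ) (f : ∀ k, V k →ₗ[ℚ] ℚ) (k : ℕ) :
    V k →ₗ[ℚ] Matrix (Fin 2) (Fin 2) (FreeGC V) where
  toFun v := !![(-1 : ℚ) ^ (s * k) • gen V k v, f k v • 1; 0, gen V k v]
  map_add' v w := by
    rw [map_add, map_add, add_smul, smul_add]
    ext i j
    fin_cases i <;> fin_cases j <;> simp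
  map_smul' c v := by
    rw [map_smul, map_smul, smul_comm, smul_assoc]
    ext i j
    fin_cases i <;> fin_cases j <;> simp

/-- Only the upper right entry is delicate: its signs $(-1)^{sp}$ and $(-1)^{pq}$ agree because
$f(w)\neq0$ only for $q=s$. -/
theorem pderivGen_comm (s : ℕ) (f : ∀ k, V k →ₗ[ℚ] ℚ) (hf : ∀ k, s ≠ k → f k = 0)
    (p q : ℕ) (v : V p) (w : V q) :
    pderivGen s f p v * pderivGen s f q w =
      (-1 : ℚ) ^ (p * q) • (pderivGen s f q w * pderivGen s f p v) := by
  have key : ∀ (p q : ℕ) (v : V p) (w : V q),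
      (-1 : ℚ) ^ (s * p) * f q w = (-1 : ℚ) ^ (p * q) * f q w := by
    intro p q v w
    by_cases h : s = q
    · subst h; rw [mul_comm s p]
    · rw [hf q h]; simp
  ext i j
  fin_cases i <;> fin_cases j
  · simp [pderivGen, Matrix.mul_apply]
    rw [gen_mul_gen v w]
    simp only [smul_smul]
    ring_nf
  · simp [pderivGen, Matrix.mul_apply]
    simp only [smul_smul]
    rw [mul_comm (f q w), key p q v w, add_comm, key q p w v, ← mul_assoc, ← pow_add,
      mul_comm q p, Even.neg_one_pow ⟨_, rfl⟩, one_mul]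
  · simp [pderivGen, Matrix.mul_apply]
  · simp [pderivGen, Matrix.mul_apply]
    rw [gen_mul_gen v w]

/-- The algebra map `a ↦ !![± a, ∂ a; 0, a]`. -/
def pderivHom (s : ℕ) (f : ∀ k, V k →ₗ[ℚ] ℚ) (hf : ∀ k, s ≠ k → f k = 0) :
    FreeGC V →ₐ[ℚ] Matrix (Fin 2) (Fin 2) (FreeGC V) :=
  lift (pderivGen s f) (pderivGen_comm s f hf)

theorem pderivHom_gen (s : ℕ) (f : ∀ k, V k →ₗ[ℚ] ℚ) (hf : ∀ k, s ≠ k → f k = 0)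
    (k : ℕ) (v : V k) : pderivHom s f hf (gen V k v) = pderivGen s f k v :=
  lift_gen _ _ k v

theorem pderivHom_one_zero (s : ℕ) (f : ∀ k, V k →ₗ[ℚ] ℚ) (hf : ∀ k, s ≠ k → f k = 0)
    (a : FreeGC V) : pderivHom s f hf a 1 0 = 0 ∧ pderivHom s f hf a 1 1 = a := by
  induction a using FreeGC.induction with
  | one => simp
  | add a b ha hb => simp [ha, hb]
  | smul c a ha =>
    rw [map_smul, Matrix.smul_apply, Matrix.smul_apply, ha.1, ha.2, smul_zero]
    exact ⟨rfl, rfl⟩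
  | gen_mul k v a ha =>
    rw [map_mul, pderivHom_gen]
    simp [Matrix.mul_apply, pderivGen, ha]

theorem pderivHom_zero_zero (s : ℕ) (f : ∀ k, V k →ₗ[ℚ] ℚ) (hf : ∀ k, s ≠ k → f k = 0)
    {n : ℕ} {a : FreeGC V} (ha : a ∈ gr V n) :
    pderivHom s f hf a 0 0 = (-1 : ℚ) ^ (s * n) • a := by
  have hw : ∀ l : List (Σ k, V k), pderivHom s f hf (word V l) 0 0 =
      (-1 : ℚ) ^ (s * (l.map Sigma.fst).sum) • word V l := by
    intro l
    induction l with
    | nil => simp [word_nil]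
    | cons t l ih =>
      rw [word_cons, map_mul, pderivHom_gen]
      simp only [Matrix.mul_apply, Fin.sum_univ_two, ih, (pderivHom_one_zero s f hf _).1, pderivGen,
        LinearMap.coe_mk, AddHom.coe_mk, Matrix.of_apply, Matrix.cons_val_zero, mul_zero, add_zero,
        smul_mul_smul_comm, List.map_cons, List.sum_cons, mul_add, pow_add]
  induction ha using Submodule.span_induction with
  | mem z hz => obtain ⟨l, rfl, rfl⟩ := hz; exact hw l
  | zero => simp
  | add a b _ _ ha hb => rw [map_add, Matrix.add_apply, ha, hb, smul_add]
  | smul c a _ ha => rw [map_smul, Matrix.smul_apply, ha, smul_comm]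

/-- The graded derivation of `ΛV` of degree `-s` that extends a linear form on `V^s`. -/
def pderiv (s : ℕ) (f : ∀ k, V k →ₗ[ℚ] ℚ) (hf : ∀ k, s ≠ k → f k = 0) :
    FreeGC V →ₗ[ℚ] FreeGC V where
  toFun a := pderivHom s f hf a 0 1
  map_add' a b := by rw [map_add, Matrix.add_apply]
  map_smul' c a := by rw [map_smul, Matrix.smul_apply, RingHom.id_apply]

variable (s : ℕ) (f : ∀ k, V k →ₗ[ℚ] ℚ) (hf : ∀ k, s ≠ k → f k = 0)

theorem pderiv_gen (k : ℕ) (v : V k) : pderiv s f hf (gen V k v) = f k v • 1 := by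
  change pderivHom s f hf _ 0 1 = _
  rw [pderivHom, lift_gen]
  simp [pderivGen]

/-- The upper right entry of a product of upper triangular matrices is a Leibniz rule; the sign sits
in the upper left entry. -/
theorem pderiv_mul {n : ℕ} {a : FreeGC V} (ha : a ∈ gr V n) (b : FreeGC V) :
    pderiv s f hf (a * b) = pderiv s f hf a * b + (-1 : ℚ) ^ (s * n) • (a * pderiv s f hf b) := by
  change pderivHom s f hf _ 0 1 = pderivHom s f hf _ 0 1 * b + _ • (a * pderivHom s f hf _ 0 1)
  rw [map_mul, Matrix.mul_apply, Fin.sum_univ_two, pderivHom_zero_zero s f hf ha,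
    (pderivHom_one_zero s f hf b).2, smul_mul_assoc, add_comm]

theorem pderiv_one : pderiv s f hf 1 = 0 := by
  change pderivHom s f hf _ 0 1 = _
  rw [map_one]
  simp

theorem pderiv_word_eq_zero (l : List (Σ k, V k)) (hl : ∀ t ∈ l, f t.1 t.2 = 0) :
    pderiv s f hf (word V l) = 0 := by
  induction l with
  | nil => rw [word_nil, pderiv_one]
  | cons t l ih =>
    rw [word_cons, pderiv_mul s f hf (gen_mem_gr _), pderiv_gen, hl t (by simp),
      ih fun t ht => hl t (by simp [ht])]
    simp

/-- The subspace spanned by the products of generators of degrees less than `p`. -/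
def lowWords (V : ℕ → Type u) [∀ k, AddCommGroup (V k)] [∀ k, Module ℚ (V k)] (p : ℕ) :
    Submodule ℚ (FreeGC V) :=
  Submodule.span ℚ {z | ∃ l : List (Σ k, V k), (∀ t ∈ l, t.1 < p) ∧ z = word V l}

theorem pderiv_lowWords {p : ℕ} (hp : p ≤ s) {a : FreeGC V} (ha : a ∈ lowWords V p) :
    pderiv s f hf a = 0 := by
  induction ha using Submodule.span_induction with
  | mem z hz =>
    obtain ⟨l, hl, rfl⟩ := hz
    refine pderiv_word_eq_zero s f hf l fun t ht => ?_
    rw [hf t.1 (by have := hl t ht; omega), LinearMap.zero_apply]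
  | zero => rw [map_zero]
  | add a b _ _ ha hb => rw [map_add, ha, hb, add_zero]
  | smul c a _ ha => rw [map_smul, ha, smul_zero]

section Basis

variable {ι : ℕ → Type*} (b : ∀ k, Module.Basis (ι k) ℚ (V k))

/-- The product of a list of elements of a homogeneous basis. -/
def bword (l : List (Σ k, ι k)) : FreeGC V := word V (l.map (basisElt b))

theorem bword_nil : bword b [] = 1 := word_nil

theorem bword_cons (z : Σ k, ι k) (l : List (Σ k, ι k)) :
    bword b (z :: l) = gen V z.1 (b z.1 z.2) * bword b l := word_cons _ _

theorem bword_mem_gr (l : List (Σ k, ι k)) : bword b l ∈ gr V (l.map Sigma.fst).sum := by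
  have h := word_mem_gr (l.map (basisElt b))
  rwa [List.map_map] at h

theorem exists_bword_eq_smul_of_perm {l l' : List (Σ k, ι k)} (h : l.Perm l') :
    ∃ c : ℚ, bword b l = c • bword b l' :=
  exists_word_eq_smul_of_perm (h.map _)

/-- A repeated odd letter can be moved next to its copy, where the square vanishes. -/
theorem notMem_of_odd {z : Σ k, ι k} (hz : Odd z.1) {l : List (Σ k, ι k)}
    (hl : bword b (z :: l) ≠ 0) : z ∉ l := by
  classical
  intro h
  obtain ⟨c, hc⟩ := exists_bword_eq_smul_of_perm b (List.perm_cons_erase h)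
  refine hl ?_
  rw [bword_cons, hc, bword_cons, mul_smul_comm, ← mul_assoc, gen_mul_self_of_odd hz, zero_mul,
    smul_zero]

/-- The partial derivative with respect to an element of a homogeneous basis. -/
def bderiv (z : Σ k, ι k) : FreeGC V →ₗ[ℚ] FreeGC V :=
  pderiv z.1 (coordForm b z) fun _ => coordForm_of_ne b

theorem bderiv_bword_of_notMem {z : Σ k, ι k} {l : List (Σ k, ι k)} (hz : z ∉ l) :
    bderiv b z (bword b l) = 0 := by
  refine pderiv_word_eq_zero _ _ _ _ fun t ht => ?_
  obtain ⟨w, hw, rfl⟩ := List.mem_map.1 ht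
  exact coordForm_basis_of_ne b fun h => hz (h ▸ hw)

/-- The Euler operator $y\,\partial_y$ of an even generator counts the occurrences of $y$ in a word.
-/
theorem gen_mul_bderiv_bword {z : Σ k, ι k} (hz : Even z.1) (l : List (Σ k, ι k)) :
    ∃ m : ℕ, gen V z.1 (b z.1 z.2) * bderiv b z (bword b l) = (m : ℚ) • bword b l := by
  induction l with
  | nil => exact ⟨0, by rw [bword_nil, bderiv, pderiv_one]; simp⟩
  | cons w l ih =>
    obtain ⟨m, hm⟩ := ih
    have hd : bderiv b z (bword b (w :: l)) = coordForm b z w.1 (b w.1 w.2) • bword b l +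
        gen V w.1 (b w.1 w.2) * bderiv b z (bword b l) := by
      rw [bword_cons, bderiv, pderiv_mul _ _ _ (gen_mem_gr _), pderiv_gen,
        (hz.mul_right _).neg_one_pow, one_smul, smul_mul_assoc, one_mul]
    have h2 : gen V z.1 (b z.1 z.2) * (gen V w.1 (b w.1 w.2) * bderiv b z (bword b l)) =
        (m : ℚ) • bword b (w :: l) := by
      rw [← mul_assoc, (commute_gen_of_even hz _ _).eq, mul_assoc, hm, mul_smul_comm, bword_cons]
    by_cases h : z = w
    · subst h
      refine ⟨m + 1, ?_⟩
      rw [hd, mul_add, h2, coordForm_self, one_smul, ← bword_cons, Nat.cast_add, Nat.cast_one,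
        add_smul, one_smul, add_comm]
    · refine ⟨m, ?_⟩
      rw [hd, mul_add, h2, coordForm_basis_of_ne b h, zero_smul, mul_zero, zero_add]

/-- A product of generators of high degrees is regular on the products of generators of low
degrees. -/
theorem eq_zero_of_mul_bword_eq_zero {p n : ℕ} {a : FreeGC V} (ha : a ∈ lowWords V p)
    (han : a ∈ gr V n) (l : List (Σ k, ι k)) (hl : ∀ z ∈ l, p ≤ z.1) (hl0 : bword b l ≠ 0)
    (h : a * bword b l = 0) : a = 0 := by
  induction l with
  | nil => rwa [bword_nil, mul_one] at h
  | cons z l ih =>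
    have hl1 : bword b l ≠ 0 := fun h' => hl0 (by rw [bword_cons, h', mul_zero])
    refine ih (fun w hw => hl w (by simp [hw])) hl1 ?_
    -- The letter `z` is strictly above all generators in `a`, so $\partial_z$ passes over `a` with
    -- only a sign and removes one `z` from the word.
    have hd := congrArg (bderiv b z) h
    rw [map_zero, bderiv, pderiv_mul _ _ _ han, pderiv_lowWords _ _ _ (hl z (by simp)) ha, zero_mul,
      zero_add, ← bderiv] at hd
    replace hd : a * bderiv b z (bword b (z :: l)) = 0 :=
      (smul_eq_zero.1 hd).resolve_left (pow_ne_zero _ (by norm_num))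
    have hz : bderiv b z (bword b (z :: l)) = bword b l + (-1 : ℚ) ^ (z.1 * z.1) •
        (gen V z.1 (b z.1 z.2) * bderiv b z (bword b l)) := by
      rw [bword_cons, bderiv, pderiv_mul _ _ _ (gen_mem_gr _), pderiv_gen, coordForm_self, one_smul,
        one_mul]
    rcases Nat.even_or_odd z.1 with he | ho
    · obtain ⟨m, hm⟩ := gen_mul_bderiv_bword b he l
      rw [hz, hm, (he.mul_right _).neg_one_pow, one_smul, mul_add, mul_smul_comm] at hd
      -- In the even case the derivative is $(m+1)$ times the shorter word, and $m+1$ is invertible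
      -- in $\mathbb{Q}$.
      have : ((1 : ℚ) + m) • (a * bword b l) = 0 := by rw [add_smul, one_smul, hd]
      exact (smul_eq_zero.1 this).resolve_left (by positivity)
    · rw [hz, bderiv_bword_of_notMem b (notMem_of_odd b ho hl0), mul_zero, smul_zero, add_zero] at hd
      exact hd

end Basis

end FreeGC

/-! ### Even generators as polynomial variables. -/

theorem Polynomial.commute_X_sub_C {R : Type*} [Ring R] {y : R} (hy : ∀ a, Commute y a)
    (g : Polynomial R) : Commute (Polynomial.X - Polynomial.C y) g := by
  refine (Polynomial.commute_X g).sub_left ?_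
  induction g using Polynomial.induction_on' with
  | add p q hp hq => exact hp.add_right hq
  | monomial n a =>
    rw [← Polynomial.C_mul_X_pow_eq_monomial]
    exact Commute.mul_right ((hy a).map Polynomial.C) (Polynomial.X_pow_mul (n := n)).symm

theorem Polynomial.exists_ringHom_eval {R : Type*} [Ring R] [Algebra ℚ R] {y : R}
    (hy : ∀ a, Commute y a) : ∃ E : Polynomial R →+* R, (∀ a, E (Polynomial.C a) = a) ∧
      (∀ (c : ℚ) g, E (c • g) = c • E g) ∧ E (Polynomial.X - Polynomial.C y) = 0 := by
  let E : Polynomial R →+* R :=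
    Polynomial.eval₂RingHom' (RingHom.id _) y fun a => (hy a).symm
  have hC : ∀ a, E (Polynomial.C a) = a := fun a => Polynomial.eval₂_C _ _
  have hX : E Polynomial.X = y := Polynomial.eval₂_X _ _
  exact ⟨E, hC, fun c g => map_rat_smul E c g, by rw [map_sub, hX, hC, sub_self]⟩

namespace FreeGC

variable {V : ℕ → Type u} [∀ k, AddCommGroup (V k)] [∀ k, Module ℚ (V k)]
variable {ι : ℕ → Type*} (b : ∀ k, Module.Basis (ι k) ℚ (V k))

section Even

variable {z : Σ k, ι k}

/-- The algebra map that replaces a generator of even degree by a polynomial variable. -/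
def evenHom (hz : Even z.1) : FreeGC V →ₐ[ℚ] Polynomial (FreeGC V) :=
  lift (B := Polynomial (FreeGC V)) (fun k =>
    { toFun v := Polynomial.C (gen V k v) +
        coordForm b z k v • (Polynomial.X - Polynomial.C (gen V z.1 (b z.1 z.2)))
      map_add' v w := by rw [map_add, map_add, map_add, add_smul]; abel
      map_smul' c v := by
        rw [LinearMap.map_smul (gen V k), LinearMap.map_smul (coordForm b z k), RingHom.id_apply,
          smul_add, ← Polynomial.smul_C, smul_assoc] }) (by
    have hT := Polynomial.commute_X_sub_C (commute_gen_of_even hz (b z.1 z.2))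
    intro p q v w
    change (Polynomial.C (gen V p v) + coordForm b z p v • _) *
      (Polynomial.C (gen V q w) + coordForm b z q w • _) = _ •
      ((Polynomial.C (gen V q w) + coordForm b z q w • _) *
      (Polynomial.C (gen V p v) + coordForm b z p v • _))
    have hC : Polynomial.C (gen V p v) * Polynomial.C (gen V q w) =
        (-1 : ℚ) ^ (p * q) • (Polynomial.C (gen V q w) * Polynomial.C (gen V p v)) := by
      rw [← Polynomial.C_mul, gen_mul_gen, ← Polynomial.smul_C, Polynomial.C_mul]
    by_cases h : z.1 = p ∨ z.1 = q
    · have he : Even (p * q) := by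
        rcases h with h | h
        · exact (h ▸ hz).mul_right _
        · exact (h ▸ hz).mul_left _
      rw [he.neg_one_pow, one_smul] at hC ⊢
      refine Commute.add_left (Commute.add_right hC ?_) (Commute.add_right ?_ ?_)
      · exact ((hT _).smul_left _).symm
      · exact (hT _).smul_left _
      · exact (hT _).smul_left _
    · rw [not_or] at h
      rw [coordForm_of_ne b h.1, coordForm_of_ne b h.2]
      simpa using hC)

theorem evenHom_gen (hz : Even z.1) (k : ℕ) (v : V k) : evenHom b hz (gen V k v) = Polynomial.C (gen V k v) +
    coordForm b z k v • (Polynomial.X - Polynomial.C (gen V z.1 (b z.1 z.2))) := by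
  rw [evenHom, lift_gen]
  rfl

theorem evenHom_gen_self (hz : Even z.1) : evenHom b hz (gen V z.1 (b z.1 z.2)) = Polynomial.X := by
  rw [evenHom_gen, coordForm_self, one_smul]
  abel

theorem evenHom_word (hz : Even z.1) (l : List (Σ k, V k)) (hl : ∀ t ∈ l, coordForm b z t.1 t.2 = 0) :
    evenHom b hz (word V l) = Polynomial.C (word V l) := by
  induction l with
  | nil => rw [word_nil, map_one, map_one]
  | cons t l ih =>
    rw [word_cons, map_mul, ih fun t ht => hl t (by simp [ht]), evenHom_gen, hl t (by simp),
      zero_smul, add_zero, Polynomial.C_mul]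

theorem evenHom_bword_of_notMem (hz : Even z.1) {l : List (Σ k, ι k)} (hl : z ∉ l) :
    evenHom b hz (bword b l) = Polynomial.C (bword b l) := by
  refine evenHom_word b hz _ fun t ht => ?_
  obtain ⟨w, hw, rfl⟩ := List.mem_map.1 ht
  exact coordForm_basis_of_ne b fun h => hl (h ▸ hw)

theorem evenHom_of_mem_lowWords (hz : Even z.1) {p : ℕ} (hp : p ≤ z.1) {a : FreeGC V} (ha : a ∈ lowWords V p) :
    evenHom b hz a = Polynomial.C a := by
  induction ha using Submodule.span_induction with
  | mem a ha =>
    obtain ⟨l, hl, rfl⟩ := ha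
    refine evenHom_word b hz l fun t ht => ?_
    rw [coordForm_of_ne b (by have := hl t ht; omega), LinearMap.zero_apply]
  | zero => rw [map_zero, map_zero]
  | add a b _ _ ha hb => rw [map_add, ha, hb, map_add]
  | smul c a _ ha => rw [map_smul, ha, Polynomial.smul_C]

/-- Evaluating the variable back at the generator, which is central, is a left inverse. -/
theorem evenHom_injective (hz : Even z.1) : Function.Injective (evenHom b hz) := by
  obtain ⟨E, hC, hs, h0⟩ := Polynomial.exists_ringHom_eval (commute_gen_of_even hz (b z.1 z.2))
  refine Function.LeftInverse.injective (g := E) fun a => ?_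
  induction a using FreeGC.induction with
  | one => rw [map_one, map_one]
  | add a b ha hb => rw [map_add, map_add, ha, hb]
  | smul c a ha => rw [map_smul, hs, ha]
  | gen_mul k v a ha =>
    rw [map_mul, map_mul, ha, evenHom_gen, map_add, hs, hC, h0, smul_zero, add_zero]

theorem eq_zero_of_gen_mul_eq_zero (hz : Even z.1) {w : FreeGC V} (h : gen V z.1 (b z.1 z.2) * w = 0) : w = 0 := by
  refine evenHom_injective b hz ?_
  have h' := congrArg (evenHom b hz) h
  rw [map_mul, evenHom_gen_self, map_zero] at h'
  rw [map_zero]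
  ext n
  have := congrArg (fun f => Polynomial.coeff f (n + 1)) h'
  simpa only [Polynomial.coeff_X_mul, Polynomial.coeff_zero] using this

theorem eq_zero_of_gen_pow_mul_eq_zero (hz : Even z.1) (k : ℕ) {w : FreeGC V}
    (h : gen V z.1 (b z.1 z.2) ^ k * w = 0) : w = 0 := by
  induction k with
  | zero => simpa using h
  | succ k ih => exact ih (eq_zero_of_gen_mul_eq_zero b hz (by rwa [← mul_assoc, ← pow_succ']))

/-- This sets the generator to zero: neither `a` nor the word contains it, so their product is the
constant coefficient. -/
theorem eq_zero_of_add_gen_mul_eq_zero (hz : Even z.1) {p : ℕ} (hp : p ≤ z.1) {a w : FreeGC V}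
    (ha : a ∈ lowWords V p) {l : List (Σ k, ι k)} (hl : z ∉ l)
    (h : a * bword b l + gen V z.1 (b z.1 z.2) * w = 0) : a * bword b l = 0 := by
  have h' := congrArg (evenHom b hz) h
  rw [map_add, map_mul, map_mul, evenHom_of_mem_lowWords b hz hp ha, evenHom_bword_of_notMem b hz hl,
    evenHom_gen_self, map_zero] at h'
  have := congrArg (fun f => Polynomial.coeff f 0) h'
  simpa [Polynomial.mul_coeff_zero] using this

end Even

end FreeGC

/-! ### The differential of a minimal algebra. -/

namespace MinimalSullivanAlgebra

open FreeGC

variable {V : ℕ → Type u} [∀ k, AddCommGroup (V k)] [∀ k, Module ℚ (V k)]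

theorem eq_zero_of_degree_lt_two (A : MinimalSullivanAlgebra V) {k : ℕ} (hk : k < 2) (v : V k) : v = 0 := by
  interval_cases k
  · exact @Subsingleton.elim _ A.subsingleton_zero _ _
  · exact @Subsingleton.elim _ A.subsingleton_one _ _

theorem word_eq_zero_of_degree_lt_two (A : MinimalSullivanAlgebra V) {l : List (Σ k, V k)} {s : Σ k, V k} (hs : s ∈ l)
    (h : s.1 < 2) : word V l = 0 := by
  obtain ⟨l1, l2, rfl⟩ := List.append_of_mem hs
  rw [word_append, word_cons, A.eq_zero_of_degree_lt_two h s.2, map_zero, zero_mul, mul_zero]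

/-- The differential of a generator involves only generators of lower degree. -/
theorem d_gen_mem_lowWords (A : MinimalSullivanAlgebra V) {p : ℕ} (v : V p) : A.d (gen V p v) ∈ lowWords V p := by
  -- Words spanning the decomposables have arbitrary degrees; the coefficient keeps those of degree
  -- $p+1$.
  have key : ∀ a ∈ decomposables V, (degreeHom a).coeff (p + 1) ∈ lowWords V p := by
    intro a ha
    induction ha using Submodule.span_induction with
    | mem a ha =>
      obtain ⟨l, hl, rfl⟩ := ha
      rw [degreeHom_of_mem (word_mem_gr l), Polynomial.coeff_monomial]
      split_ifs with h
      swap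
      · exact zero_mem _
      by_cases h2 : ∀ s ∈ l, 2 ≤ s.1
      swap
      · push Not at h2
        obtain ⟨s, hs, h2⟩ := h2
        rw [A.word_eq_zero_of_degree_lt_two hs h2]
        exact zero_mem _
      refine Submodule.subset_span ⟨l, fun t ht => ?_, rfl⟩
      obtain ⟨l1, l2, rfl⟩ := List.append_of_mem ht
      obtain ⟨s, hs⟩ : ∃ s, s ∈ l1 ++ l2 := by
        refine List.exists_mem_of_length_pos ?_
        simp only [List.length_append, List.length_cons] at hl ⊢
        omega
      -- Another letter takes up at least 2 of the total degree $p+1$, leaving at most $p-1$ for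
      -- `t`.
      have h3 := List.single_le_sum (l := (l1 ++ l2).map Sigma.fst) (by simp) s.1
        (List.mem_map_of_mem hs)
      have h4 := h2 s (by simp only [List.mem_append, List.mem_cons] at hs ⊢; tauto)
      simp only [List.map_append, List.map_cons, List.sum_append, List.sum_cons] at h h3
      omega
    | zero => simp
    | add a b _ _ ha hb => rw [map_add, Polynomial.coeff_add]; exact add_mem ha hb
    | smul c a _ ha => rw [map_smul, Polynomial.coeff_smul]; exact Submodule.smul_mem _ _ ha
  have h := key _ (A.d_decomposable (gen V p v))
  rwa [degreeHom_of_mem (A.d_mem p _ (gen_mem_gr v)), Polynomial.coeff_monomial, if_pos rfl] at h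

/-- The common factor $v^k$ is kept outside so that it can be cancelled before setting $v=0$. -/
theorem d_pow_mul (A : MinimalSullivanAlgebra V) {p : ℕ} (hp : Even p) (v : V p) (k : ℕ) (w : FreeGC V) :
    A.d (gen V p v ^ (k + 1) * w) = gen V p v ^ k *
      (A.d (gen V p v) * ((k + 1 : ℚ) • w) + gen V p v * A.d w) := by
  have h1 : ∀ w, A.d (gen V p v * w) = A.d (gen V p v) * w + gen V p v * A.d w := by
    intro w
    rw [A.d_mul p _ _ (gen_mem_gr v), hp.neg_one_pow, one_smul]
  induction k generalizing w with
  | zero => simp [h1]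
  | succ k ih =>
    rw [pow_succ _ (k + 1), mul_assoc, ih, h1, pow_succ _ k, mul_assoc]
    congr 1
    have hc := (commute_gen_of_even hp v (A.d (gen V p v))).eq
    simp only [mul_add, mul_smul_comm, ← mul_assoc, hc, Nat.cast_add, Nat.cast_one, add_smul, one_smul]
    abel

end MinimalSullivanAlgebra

theorem List.exists_perm_cons_forall_le {α : Type*} (f : α → ℕ) (l : List α) (hl : l ≠ []) :
    ∃ z l', l.Perm (z :: l') ∧ ∀ w ∈ l', f z ≤ f w := by
  induction l with
  | nil => exact absurd rfl hl
  | cons a l ih =>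
    by_cases h : l = []
    · subst h; exact ⟨a, [], List.Perm.refl _, by simp⟩
    · obtain ⟨z, l', hp, hz⟩ := ih h
      rcases le_total (f a) (f z) with h1 | h1
      · refine ⟨a, z :: l', hp.cons a, ?_⟩
        simp only [List.mem_cons, forall_eq_or_imp]
        exact ⟨h1, fun w hw => h1.trans (hz w hw)⟩
      · refine ⟨z, a :: l', (hp.cons a).trans (List.Perm.swap _ _ _), ?_⟩
        simp only [List.mem_cons, forall_eq_or_imp]
        exact ⟨h1, hz⟩

theorem List.exists_perm_replicate_append {α : Type*} (z : α) (l : List α) :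
    ∃ k l', z ∉ l' ∧ l.Perm (List.replicate k z ++ l') := by
  induction l with
  | nil => exact ⟨0, [], by simp, by simp⟩
  | cons a l ih =>
    obtain ⟨k, l', hz, hp⟩ := ih
    by_cases h : z = a
    · subst h
      exact ⟨k + 1, l', hz, hp.cons z⟩
    · refine ⟨k, a :: l', by simp [h, hz], (hp.cons a).trans List.perm_middle.symm⟩

/-! ### Monomial cocycles and the degree bound. -/

namespace MinimalSullivanAlgebra

open FreeGC

variable {V : ℕ → Type u} [∀ k, AddCommGroup (V k)] [∀ k, Module ℚ (V k)]
variable {ι : ℕ → Type*} (b : ∀ k, Module.Basis (ι k) ℚ (V k))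

theorem d_gen_mul (A : MinimalSullivanAlgebra V) {p : ℕ} (v : V p) (w : FreeGC V) :
    A.d (gen V p v * w) = A.d (gen V p v) * w + (-1 : ℚ) ^ p • (gen V p v * A.d w) :=
  A.d_mul p _ _ (gen_mem_gr v)

/-- A letter of least odd degree in a monomial cocycle is a cocycle. -/
theorem d_gen_eq_zero_of_odd (A : MinimalSullivanAlgebra V) {z : Σ k, ι k} {l : List (Σ k, ι k)}
    (hmin : ∀ w ∈ l, z.1 ≤ w.1) (hl : bword b (z :: l) ≠ 0) (hd : A.d (bword b (z :: l)) = 0)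
    (hz : Odd z.1) : A.d (gen V z.1 (b z.1 z.2)) = 0 := by
  refine eq_zero_of_mul_bword_eq_zero b (A.d_gen_mem_lowWords _) (A.d_mem _ _ (gen_mem_gr _))
    (z :: l) (by simpa using hmin) hl ?_
  set y := gen V z.1 (b z.1 z.2) with hy
  have hyy : y * y = 0 := gen_mul_self_of_odd hz _
  -- Differentiate $y^2=0$. Multiplying $d(yQ)=0$ by $y$ then leaves $dy\cdot yQ=0$, to which
  -- regularity applies.
  have hc : y * A.d y = A.d y * y := by
    have h := A.d_gen_mul (b z.1 z.2) y
    rw [← hy, hyy, map_zero, hz.neg_one_pow, neg_one_smul_eq] at h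
    exact (eq_of_sub_eq_zero (by rw [sub_eq_add_neg]; exact h.symm)).symm
  have h := congrArg (y * ·) hd
  simp only [mul_zero] at h
  rwa [bword_cons, d_gen_mul, mul_add, ← hy, mul_smul_comm, ← mul_assoc y y, hyy, zero_mul,
    smul_zero, add_zero, ← mul_assoc, hc, mul_assoc, hy, ← bword_cons] at h

/-- A letter of least even degree in a monomial cocycle is a cocycle, and so is its cofactor. -/
theorem d_gen_eq_zero_of_even (A : MinimalSullivanAlgebra V) {z : Σ k, ι k} {l : List (Σ k, ι k)}
    (hmin : ∀ w ∈ l, z.1 ≤ w.1) (hl : bword b (z :: l) ≠ 0) (hd : A.d (bword b (z :: l)) = 0)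
    (hz : Even z.1) : A.d (gen V z.1 (b z.1 z.2)) = 0 ∧ A.d (bword b l) = 0 := by
  set y := gen V z.1 (b z.1 z.2) with hy
  -- All copies of the letter are collected, so that the remaining word `l'` is free of it.
  obtain ⟨k, l', hzl, hp⟩ := List.exists_perm_replicate_append z l
  obtain ⟨c, hc⟩ := exists_bword_eq_smul_of_perm b hp
  have hrep : ∀ k, bword b (List.replicate k z ++ l') = y ^ k * bword b l' := by
    intro k
    induction k with
    | zero => simp
    | succ k ih =>
      rw [List.replicate_succ, List.cons_append, bword_cons, ih, ← mul_assoc, ← hy, ← pow_succ']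
  rw [hrep] at hc
  have hQ : bword b l ≠ 0 := fun h => hl (by rw [bword_cons, h, mul_zero])
  have hc0 : c ≠ 0 := fun h => hQ (by rw [hc, h, zero_smul])
  have hQ' : bword b l' ≠ 0 := fun h => hQ (by rw [hc, h, mul_zero, smul_zero])
  have hd' : A.d (y ^ (k + 1) * bword b l') = 0 := by
    rw [bword_cons, hc, mul_smul_comm, ← hy, ← mul_assoc, ← pow_succ', map_smul] at hd
    exact (smul_eq_zero.1 hd).resolve_left hc0
  rw [hy, d_pow_mul _ hz] at hd'
  have h1 := eq_zero_of_gen_pow_mul_eq_zero b hz k hd'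
  -- Having cancelled $y^k$, set $y=0$ in $(k+1)\,dy\,Q'+y\,dQ'=0$; neither $dy$ nor $Q'$ contains
  -- $y$.
  have h2 : (k + 1 : ℚ) • A.d y * bword b l' = 0 := by
    refine eq_zero_of_add_gen_mul_eq_zero b hz le_rfl
      (Submodule.smul_mem _ _ (A.d_gen_mem_lowWords _)) hzl (w := A.d (bword b l')) ?_
    rwa [smul_mul_assoc, ← mul_smul_comm]
  rw [smul_mul_assoc] at h2
  have h3 : A.d y = 0 := by
    refine eq_zero_of_mul_bword_eq_zero b (A.d_gen_mem_lowWords _) (A.d_mem _ _ (gen_mem_gr _))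
      l' (fun w hw => hmin w (hp.symm.subset (by simp [hw]))) hQ'
      ((smul_eq_zero.1 h2).resolve_left (by positivity))
  refine ⟨h3, eq_zero_of_gen_mul_eq_zero b hz ?_⟩
  rwa [bword_cons, d_gen_mul, ← hy, h3, zero_mul, zero_add, hz.neg_one_pow, one_smul] at hd

theorem gen_mul_mem_decomposables {p j : ℕ} (v : V p) (hj : 0 < j) {a : FreeGC V}
    (ha : a ∈ gr V j) : gen V p v * a ∈ decomposables V := by
  induction ha using Submodule.span_induction with
  | mem a ha =>
    obtain ⟨l, hl, rfl⟩ := ha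
    refine Submodule.subset_span ⟨⟨p, v⟩ :: l, ?_, (word_cons ⟨p, v⟩ l).symm⟩
    cases l with
    | nil => simp at hl; omega
    | cons => simp
  | zero => rw [mul_zero]; exact zero_mem _
  | add a b _ _ ha hb => rw [mul_add]; exact add_mem ha hb
  | smul c a _ ha => rw [mul_smul_comm]; exact Submodule.smul_mem _ _ ha

/-- If the cohomology of a minimal Sullivan algebra vanishes above degree `N`, an odd Gottlieb
element with monomial differential has degree less than `2 N`. -/
theorem degree_lt_of_isGottlieb (A : MinimalSullivanAlgebra V) {n N : ℕ}
    {x : V (2 * n + 1)} (hx : A.IsGottlieb x)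
    (hmon : IsMonomial V b (A.d (gen V (2 * n + 1) x)))
    (hex : ∀ k, N ≤ k → ∀ a ∈ gr V (k + 1), A.d a = 0 → ∃ w ∈ gr V k, A.d w = a) :
    2 * n + 1 < 2 * N := by
  by_contra hcon
  have hN : N ≤ n := by omega
  obtain ⟨θ, hθ, hθd, hθx⟩ := hx
  have hx0 : gen V (2 * n + 1) x ∉ decomposables V := by
    intro h
    rw [eq_zero_of_gen_mem_decomposables h, map_zero, map_zero] at hθx
    exact zero_ne_one hθx
  have hnb : ∀ z : Σ k, ι k, gen V z.1 (b z.1 z.2) ∉ decomposables V := fun z h =>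
    (b z.1).ne_zero z.2 (eq_zero_of_gen_mem_decomposables h)
  have h2 : ∀ z : Σ k, ι k, 2 ≤ z.1 := by
    intro z
    by_contra h
    exact (b z.1).ne_zero z.2 (A.eq_zero_of_degree_lt_two (by omega) _)
  obtain ⟨c, l, hD⟩ := hmon
  change _ = c • bword b l at hD
  -- If `x` were a cocycle, it would be exact, as its degree exceeds `N`, and hence decomposable.
  by_cases hD0 : A.d (gen V (2 * n + 1) x) = 0
  · obtain ⟨w, -, hw⟩ := hex (2 * n) (by omega) _ (gen_mem_gr x) hD0
    exact hx0 (hw ▸ A.d_decomposable w)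
  have hc0 : c ≠ 0 := fun h => hD0 (by rw [hD, h, zero_smul])
  have hl0 : bword b l ≠ 0 := fun h => hD0 (by rw [hD, h, smul_zero])
  have hlne : l ≠ [] := by
    rintro rfl
    have := A.d_decomposable (gen V (2 * n + 1) x)
    rw [hD, bword_nil] at this
    exact smul_one_notMem_decomposables hc0 this
  obtain ⟨z, l', hp, hmin⟩ := List.exists_perm_cons_forall_le Sigma.fst l hlne
  obtain ⟨c', hc'⟩ := exists_bword_eq_smul_of_perm b hp
  have hc'0 : c * c' ≠ 0 := mul_ne_zero hc0 fun h => hl0 (by rw [hc', h, zero_smul])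
  rw [hc', smul_smul] at hD
  generalize c * c' = e at hD hc'0
  have hzl0 : bword b (z :: l') ≠ 0 := fun h => hl0 (by rw [hc', h, smul_zero])
  have hdeg : z.1 + (l'.map Sigma.fst).sum = 2 * n + 2 := by
    refine eq_of_mem_gr (bword_mem_gr b (z :: l')) ?_ hzl0
    have := A.d_mem _ _ (gen_mem_gr x)
    rw [hD] at this
    simpa [smul_smul, inv_mul_cancel₀ hc'0] using Submodule.smul_mem _ e⁻¹ this
  have hl'ne : l' ≠ [] := by
    rintro rfl
    have := A.d_decomposable (gen V (2 * n + 1) x)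
    rw [hD, bword_cons, bword_nil, mul_one] at this
    refine hnb z ?_
    simpa [smul_smul, inv_mul_cancel₀ hc'0] using Submodule.smul_mem _ e⁻¹ this
  -- With `hdeg`, this gives the cofactor degree at least $n+1$, which is where the factor 2 in the
  -- bound comes from.
  have hzle : z.1 ≤ (l'.map Sigma.fst).sum := by
    obtain ⟨w, hw⟩ := List.exists_mem_of_ne_nil _ hl'ne
    exact (hmin w hw).trans (List.single_le_sum (by simp) _ (List.mem_map_of_mem hw))
  have hdD : A.d (bword b (z :: l')) = 0 := by
    have := A.d_d (gen V (2 * n + 1) x)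
    rw [hD, map_smul] at this
    exact (smul_eq_zero.1 this).resolve_left hc'0
  have hz2 := h2 z
  rcases Nat.even_or_odd z.1 with hz | hz
  · obtain ⟨hdy, hdQ⟩ := A.d_gen_eq_zero_of_even b hmin hzl0 hdD hz
    obtain ⟨j, hj⟩ : ∃ j, (l'.map Sigma.fst).sum = j + 1 := ⟨(l'.map Sigma.fst).sum - 1, by omega⟩
    -- The cofactor $Q$ is exact, $Q=dw$, so $e\,yw$ is a decomposable element with the same
    -- differential as $x$.
    obtain ⟨w, hw, hdw⟩ := hex j (by omega) _ (hj ▸ bword_mem_gr b l') hdQ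
    have hyw : gen V z.1 (b z.1 z.2) * w ∈ gr V (2 * n + 1) := by
      have := mul_mem_gr V (gen_mem_gr (b z.1 z.2)) hw
      rwa [show z.1 + j = 2 * n + 1 by omega] at this
    obtain ⟨w', -, hdw'⟩ := hex (2 * n) (by omega)
      (gen V (2 * n + 1) x - e • (gen V z.1 (b z.1 z.2) * w))
      (sub_mem (gen_mem_gr x) (Submodule.smul_mem _ _ hyw)) (by
        rw [map_sub, map_smul, hD, d_gen_mul, hdy, zero_mul, zero_add, hz.neg_one_pow, one_smul, hdw,
          bword_cons, sub_self])
    refine hx0 ?_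
    have h1 : gen V (2 * n + 1) x = A.d w' + e • (gen V z.1 (b z.1 z.2) * w) := by
      rw [hdw', sub_add_cancel]
    rw [h1]
    exact add_mem (A.d_decomposable _)
      (Submodule.smul_mem _ _ (gen_mul_mem_decomposables _ (by omega) hw))
  · have hdy := A.d_gen_eq_zero_of_odd b hmin hzl0 hdD hz
    -- The product $yx$ is closed because $d(yx)=-e\,y\cdot yQ$ and $y^2=0$.
    obtain ⟨w, -, hdw⟩ := hex (z.1 + 2 * n) (by omega)
      (gen V z.1 (b z.1 z.2) * gen V (2 * n + 1) x)
      (show _ ∈ gr V (z.1 + (2 * n + 1)) from mul_mem_gr V (gen_mem_gr _) (gen_mem_gr _)) (by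
        rw [d_gen_mul, hdy, zero_mul, zero_add, hD, bword_cons, mul_smul_comm, ← mul_assoc,
          gen_mul_self_of_odd hz, zero_mul, smul_zero, smul_zero])
    -- Here $2\le|y|\le n+1$, so $|y|<2n+1$ and $\theta y=0$; only $\theta x=1$ contributes.
    have h1 : θ (A.d w) = -gen V z.1 (b z.1 z.2) := by
      rw [hdw, hθ.leibniz _ _ _ (gen_mem_gr _), hθ.eq_zero z.1 _ (by omega) (gen_mem_gr _), zero_mul,
        zero_add, hθx, mul_one, (hz.mul ⟨n, rfl⟩).neg_one_pow, neg_one_smul_eq]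
    have h3 := hθd w
    rw [Odd.neg_one_pow ⟨n, rfl⟩, h1, neg_one_smul_eq, neg_neg] at h3
    exact hnb z (by rw [← sub_eq_zero.1 h3]; exact A.d_decomposable _)

end MinimalSullivanAlgebra

/-! ### Radial integration of polynomials. -/

namespace MvPolynomial

variable {σ τ : Type*}

/-- The operator multiplying a homogeneous polynomial of degree `d` by `1 / (d + q + 1)`. -/
def radialIntegral (σ : Type*) (q : ℕ) : MvPolynomial σ ℚ →ₗ[ℚ] MvPolynomial σ ℚ :=
  (basisMonomials σ ℚ).constr ℚ fun s => monomial s (1 / (s.degree + q + 1 : ℚ))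

theorem radialIntegral_monomial (q : ℕ) (s : σ →₀ ℕ) (a : ℚ) :
    radialIntegral σ q (monomial s a) = (1 / (s.degree + q + 1 : ℚ)) • monomial s a := by
  have h : monomial s a = a • basisMonomials σ ℚ s := by
    rw [coe_basisMonomials, smul_monomial, smul_eq_mul, mul_one]
  rw [h, map_smul, radialIntegral, Module.Basis.constr_basis, coe_basisMonomials, smul_monomial,
    smul_monomial, smul_monomial]
  congr 1
  simp only [smul_eq_mul]
  ring

theorem radialIntegral_of_isHomogeneous (q : ℕ) {d : ℕ} {f : MvPolynomial σ ℚ}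
    (hf : f.IsHomogeneous d) : radialIntegral σ q f = (1 / (d + q + 1 : ℚ)) • f := by
  conv_lhs => rw [f.as_sum]
  conv_rhs => rw [f.as_sum]
  rw [map_sum, Finset.smul_sum]
  refine Finset.sum_congr rfl fun s hs => ?_
  rw [radialIntegral_monomial]
  have h : s.degree = d := by
    rw [← hf (mem_support_iff.1 hs), Finsupp.degree_eq_weight_one]
    rfl
  rw [h]

/-- Linear substitutions preserve the degree, and the operator depends only on the degree. -/
theorem radialIntegral_aeval (q : ℕ) (g : σ → MvPolynomial τ ℚ) (hg : ∀ j, (g j).IsHomogeneous 1)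
    (f : MvPolynomial σ ℚ) : radialIntegral τ q (aeval g f) = aeval g (radialIntegral σ q f) := by
  induction f using induction_on' with
  | add f f' hf hf' => simp only [map_add, hf, hf']
  | monomial s a =>
    have h := isHomogeneous_monomial (R := ℚ) (d := s) (n := s.degree) a rfl
    have h' := h.aeval g hg
    rw [one_mul] at h'
    rw [radialIntegral_of_isHomogeneous q h, radialIntegral_of_isHomogeneous q h', map_smul]

theorem pderiv_radialIntegral (q : ℕ) (j : σ) (f : MvPolynomial σ ℚ) :
    pderiv j (radialIntegral σ q f) = radialIntegral σ (q + 1) (pderiv j f) := by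
  induction f using induction_on' with
  | add f f' hf hf' => simp only [map_add, hf, hf']
  | monomial s a =>
    have h := isHomogeneous_monomial (R := ℚ) (d := s) (n := s.degree) a rfl
    by_cases hs : s = 0
    · subst hs
      have h0 : pderiv j (monomial 0 a : MvPolynomial σ ℚ) = 0 := pderiv_C
      rw [radialIntegral_of_isHomogeneous q h, Derivation.map_smul, h0, smul_zero, map_zero]
    · have hd : (((s.degree - 1 : ℕ) : ℚ)) = s.degree - 1 := by
        rw [Nat.cast_sub, Nat.cast_one]
        exact Nat.one_le_iff_ne_zero.2 (by simpa [Finsupp.degree_eq_zero_iff] using hs)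
      rw [radialIntegral_of_isHomogeneous q h, radialIntegral_of_isHomogeneous (q + 1) h.pderiv,
        Derivation.map_smul, hd]
      congr 2
      push_cast
      ring

/-- By Euler's identity, a homogeneous polynomial of degree $d$ acquires the factor $(q+1)+d$, which
cancels the denominator. It is integration by parts for $\int_0^1u^qf(ux)\,du$. -/
theorem radialIntegral_euler [Fintype σ] (q : ℕ) (f : MvPolynomial σ ℚ) :
    (q + 1 : ℚ) • radialIntegral σ q f +
      ∑ j, X j * radialIntegral σ (q + 1) (pderiv j f) = f := by
  induction f using induction_on' with
  | add f f' hf hf' =>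
    conv_rhs => rw [← hf, ← hf']
    simp only [map_add, mul_add, Finset.sum_add_distrib, smul_add]
    abel
  | monomial s a =>
    have h := isHomogeneous_monomial (R := ℚ) (d := s) (n := s.degree) a rfl
    simp only [← pderiv_radialIntegral]
    rw [radialIntegral_of_isHomogeneous q h]
    simp only [Derivation.map_smul, mul_smul_comm]
    rw [← Finset.smul_sum, h.sum_X_mul_pderiv, smul_comm, ← smul_add, ← Nat.cast_smul_eq_nsmul ℚ,
      ← add_smul, smul_smul]
    have : ((s.degree : ℚ) + q + 1) ≠ 0 := by positivity
    rw [show (1 / (s.degree + q + 1 : ℚ)) * (q + 1 + s.degree) = 1 by field_simp; ring, one_smul]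

/-- The fundamental theorem of calculus along the rays from the origin. -/
theorem radialIntegral_euler_zero [Fintype σ] (f : MvPolynomial σ ℚ) :
    ∑ j, X j * radialIntegral σ 0 (pderiv j f) = f - C (constantCoeff f) := by
  induction f using induction_on' with
  | add f f' hf hf' =>
    simp only [map_add, mul_add, Finset.sum_add_distrib, hf, hf']
    ring
  | monomial s a =>
    by_cases hs : s = 0
    · subst hs
      have h0 : ∀ j, pderiv j (monomial 0 a : MvPolynomial σ ℚ) = 0 := fun j => pderiv_C
      simp only [h0, map_zero, mul_zero, Finset.sum_const_zero]
      simp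
    · have h := isHomogeneous_monomial (R := ℚ) (d := s) (n := s.degree) a rfl
      have hs0 : s.degree ≠ 0 := by simpa [Finsupp.degree_eq_zero_iff] using hs
      have hd : (((s.degree - 1 : ℕ) : ℚ)) = s.degree - 1 := by
        rw [Nat.cast_sub, Nat.cast_one]
        exact Nat.one_le_iff_ne_zero.2 hs0
      simp only [radialIntegral_of_isHomogeneous 0 h.pderiv, mul_smul_comm]
      rw [← Finset.smul_sum, h.sum_X_mul_pderiv, ← Nat.cast_smul_eq_nsmul ℚ, smul_smul, hd]
      have hq : (s.degree : ℚ) ≠ 0 := by exact_mod_cast hs0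
      have hc : constantCoeff (monomial s a : MvPolynomial σ ℚ) = 0 := by
        classical rw [constantCoeff_monomial, if_neg hs]
      rw [hc, map_zero, sub_zero,
        show (1 / ((s.degree : ℚ) - 1 + (0 : ℕ) + 1) * s.degree) = 1 by
          push_cast; rw [add_zero, sub_add_cancel]; field_simp, one_smul]

end MvPolynomial

/-! ### Cones on the simplex and the Poincaré lemma. -/

/-- The affine coordinates of the vertices of the simplex. -/
def vertexCoord {n : ℕ} (i : Fin (n + 1)) (j : Fin n) : ℚ := if i = j.succ then 1 else 0

/-- The affine coordinates centered at a vertex. -/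
def centeredCoord {n : ℕ} (i : Fin (n + 1)) (j : Fin n) : MvPolynomial (Fin n) ℚ :=
  MvPolynomial.X j - MvPolynomial.C (vertexCoord i j)

/-- The substitution of the coordinates centered at a vertex. -/
def centerAt {n : ℕ} (i : Fin (n + 1)) : MvPolynomial (Fin n) ℚ →ₐ[ℚ] MvPolynomial (Fin n) ℚ :=
  MvPolynomial.aeval (centeredCoord i)

/-- The inverse of the substitution of the coordinates centered at a vertex. -/
def uncenterAt {n : ℕ} (i : Fin (n + 1)) : MvPolynomial (Fin n) ℚ →ₐ[ℚ] MvPolynomial (Fin n) ℚ :=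
  MvPolynomial.aeval fun j => MvPolynomial.X j + MvPolynomial.C (vertexCoord i j)

theorem centerAt_uncenterAt {n : ℕ} (i : Fin (n + 1)) (f : MvPolynomial (Fin n) ℚ) :
    centerAt i (uncenterAt i f) = f := by
  have h : (centerAt i).comp (uncenterAt i) = AlgHom.id ℚ _ := by
    refine MvPolynomial.algHom_ext fun j => ?_
    simp [centerAt, uncenterAt, centeredCoord]
  exact DFunLike.congr_fun h f

theorem uncenterAt_centerAt {n : ℕ} (i : Fin (n + 1)) (f : MvPolynomial (Fin n) ℚ) :
    uncenterAt i (centerAt i f) = f := by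
  have h : (uncenterAt i).comp (centerAt i) = AlgHom.id ℚ _ := by
    refine MvPolynomial.algHom_ext fun j => ?_
    simp [centerAt, uncenterAt, centeredCoord]
  exact DFunLike.congr_fun h f

theorem pderiv_uncenterAt {n : ℕ} (i : Fin (n + 1)) (j : Fin n) (f : MvPolynomial (Fin n) ℚ) :
    MvPolynomial.pderiv j (uncenterAt i f) = uncenterAt i (MvPolynomial.pderiv j f) := by
  induction f using MvPolynomial.induction_on with
  | C a => simp [uncenterAt]
  | add f g hf hg => simp only [map_add, hf, hg]
  | mul_X f k hf =>
    rw [map_mul, MvPolynomial.pderiv_mul, MvPolynomial.pderiv_mul, hf, map_add, map_mul, map_mul]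
    congr 2
    simp [uncenterAt, MvPolynomial.pderiv_X, Pi.single_apply, apply_ite]

theorem pderiv_centerAt {n : ℕ} (i : Fin (n + 1)) (j : Fin n) (f : MvPolynomial (Fin n) ℚ) :
    MvPolynomial.pderiv j (centerAt i f) = centerAt i (MvPolynomial.pderiv j f) := by
  rw [← centerAt_uncenterAt i (MvPolynomial.pderiv j (centerAt i f)), ← pderiv_uncenterAt,
    uncenterAt_centerAt]

/-- The operator `f ↦ ∫₀¹ u^q f(e + u (x - e)) du` for a vertex `e` of the simplex. -/
def coneIntegral {n : ℕ} (i : Fin (n + 1)) (q : ℕ) :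
    MvPolynomial (Fin n) ℚ →ₗ[ℚ] MvPolynomial (Fin n) ℚ :=
  (centerAt i).toLinearMap ∘ₗ MvPolynomial.radialIntegral (Fin n) q ∘ₗ (uncenterAt i).toLinearMap

theorem coneIntegral_apply {n : ℕ} (i : Fin (n + 1)) (q : ℕ) (f : MvPolynomial (Fin n) ℚ) :
    coneIntegral i q f = centerAt i (MvPolynomial.radialIntegral (Fin n) q (uncenterAt i f)) := rfl

theorem pderiv_coneIntegral {n : ℕ} (i : Fin (n + 1)) (q : ℕ) (j : Fin n)
    (f : MvPolynomial (Fin n) ℚ) : MvPolynomial.pderiv j (coneIntegral i q f) =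
      coneIntegral i (q + 1) (MvPolynomial.pderiv j f) := by
  rw [coneIntegral_apply, coneIntegral_apply, pderiv_centerAt, MvPolynomial.pderiv_radialIntegral,
    pderiv_uncenterAt]

theorem coneIntegral_euler {n : ℕ} (i : Fin (n + 1)) (q : ℕ) (f : MvPolynomial (Fin n) ℚ) :
    (q + 1 : ℚ) • coneIntegral i q f +
      ∑ j, centeredCoord i j * coneIntegral i (q + 1) (MvPolynomial.pderiv j f) = f := by
  have h := congrArg (centerAt i) (MvPolynomial.radialIntegral_euler q (uncenterAt i f))
  rw [centerAt_uncenterAt, map_add, map_smul, map_sum] at h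
  simp only [map_mul, pderiv_uncenterAt, ← coneIntegral_apply] at h
  simpa [centerAt] using h

theorem coneIntegral_euler_zero {n : ℕ} (i : Fin (n + 1)) (f : MvPolynomial (Fin n) ℚ) :
    ∑ j, centeredCoord i j * coneIntegral i 0 (MvPolynomial.pderiv j f) =
      f - MvPolynomial.C (MvPolynomial.constantCoeff (uncenterAt i f)) := by
  have h := congrArg (centerAt i) (MvPolynomial.radialIntegral_euler_zero (uncenterAt i f))
  rw [map_sub, centerAt_uncenterAt, map_sum] at h
  simp only [map_mul, pderiv_uncenterAt, ← coneIntegral_apply] at h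
  simpa [centerAt] using h

theorem baryCoord_sub_vertex {m : ℕ} (i k : Fin (m + 1)) :
    baryCoord m k - MvPolynomial.C (if i = k then 1 else 0) =
      ∑ l, baryTangent m (Pi.single l 1) k • centeredCoord i l := by
  refine Fin.cases ?_ (fun k => ?_) k
  · simp only [baryCoord, baryTangent, Fin.cons_zero, centeredCoord, vertexCoord]
    refine Fin.cases ?_ (fun i => ?_) i
    · simp [(Fin.succ_ne_zero _).symm]
    · have h : ∀ l : Fin m, (-∑ k, (Pi.single l 1 : Fin m → ℚ) k) • ((MvPolynomial.X l :
          MvPolynomial (Fin m) ℚ) - MvPolynomial.C (if i.succ = l.succ then 1 else 0)) =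
          (if i = l then 1 else 0) - MvPolynomial.X l := by
        intro l
        simp only [Fin.succ_inj]
        split_ifs <;> simp
      simp only [h]
      simp [Finset.sum_sub_distrib]
  · simp [baryCoord, baryTangent, centeredCoord, vertexCoord, Pi.single_apply, ite_smul]

theorem sum_baryCoord (n : ℕ) : ∑ i, baryCoord n i = 1 := by
  simp [Fin.sum_univ_succ, baryCoord]

theorem pullPoly_baryCoord {m n : ℕ} (α : Fin (m + 1) → Fin (n + 1)) (j : Fin (n + 1)) :
    pullPoly α (baryCoord n j) = ∑ i with α i = j, baryCoord m i := by
  have hs : ∀ j : Fin n, pullPoly α (baryCoord n j.succ) =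
      ∑ i with α i = j.succ, baryCoord m i := by
    intro j
    simp [pullPoly, baryCoord]
  refine Fin.cases ?_ hs j
  -- The pullback is defined on $t_1,\dots,t_n$ only; the case of $t_0$ follows because the
  -- coordinates sum to 1 on both sides.
  have h := congrArg (pullPoly α) (sum_baryCoord n)
  rw [map_sum, Fin.sum_univ_succ, map_one, ← sum_baryCoord m,
    ← Finset.sum_fiberwise (s := Finset.univ) (g := α), Fin.sum_univ_succ] at h
  simpa [hs] using h

/-- The affine map takes vertex `i` to vertex `α i`, so in coordinates centered there it is linear,
without constant term. -/
theorem pullPoly_centeredCoord {m n : ℕ} (α : Fin (m + 1) → Fin (n + 1)) (i : Fin (m + 1))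
    (j : Fin n) : pullPoly α (centeredCoord (α i) j) =
      ∑ l, pushTangent α (Pi.single l 1) j • centeredCoord i l := by
  have h1 : pullPoly α (centeredCoord (α i) j) =
      ∑ k with α k = j.succ, (baryCoord m k - MvPolynomial.C (if i = k then 1 else 0)) := by
    rw [Finset.sum_sub_distrib, ← pullPoly_baryCoord]
    have h2 : ∑ k with α k = j.succ, (MvPolynomial.C (if i = k then 1 else 0) :
        MvPolynomial (Fin m) ℚ) = MvPolynomial.C (vertexCoord (α i) j) := by
      rw [← map_sum, Finset.sum_ite_eq]
      simp [vertexCoord]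
    have h3 : pullPoly α (MvPolynomial.C (vertexCoord (α i) j)) =
        MvPolynomial.C (vertexCoord (α i) j) := by simp [pullPoly]
    rw [h2, centeredCoord, map_sub, h3]
    rfl
  rw [h1]
  simp only [baryCoord_sub_vertex]
  rw [Finset.sum_comm]
  refine Finset.sum_congr rfl fun l _ => ?_
  simp [pushTangent, Finset.sum_smul]

theorem pullPoly_coneIntegral {m n : ℕ} (α : Fin (m + 1) → Fin (n + 1)) (i : Fin (m + 1)) (q : ℕ)
    (f : MvPolynomial (Fin n) ℚ) :
    pullPoly α (coneIntegral (α i) q f) = coneIntegral i q (pullPoly α f) := by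
  let g : Fin n → MvPolynomial (Fin m) ℚ := fun j =>
    ∑ l, pushTangent α (Pi.single l 1) j • MvPolynomial.X l
  have hg : ∀ j, (g j).IsHomogeneous 1 := fun j =>
    MvPolynomial.IsHomogeneous.sum _ _ _ fun l _ => by
      rw [MvPolynomial.smul_eq_C_mul]
      simpa using (MvPolynomial.isHomogeneous_C _ _).mul (MvPolynomial.isHomogeneous_X ℚ l)
  have h : ((pullPoly α).comp (centerAt (α i))) = (centerAt i).comp (MvPolynomial.aeval g) := by
    refine MvPolynomial.algHom_ext fun j => ?_
    simp [centerAt, pullPoly_centeredCoord, g]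
  have h1 : ∀ f, pullPoly α (centerAt (α i) f) = centerAt i (MvPolynomial.aeval g f) :=
    DFunLike.congr_fun h
  rw [coneIntegral_apply, coneIntegral_apply, h1, ← MvPolynomial.radialIntegral_aeval q g hg]
  congr 2
  rw [← centerAt_uncenterAt (α i) f, h1, uncenterAt_centerAt, uncenterAt_centerAt]

theorem AlternatingMap.sum_apply {R M N ι κ : Type*} [CommSemiring R] [AddCommMonoid M]
    [Module R M] [AddCommMonoid N] [Module R N] (s : Finset κ) (f : κ → M [⋀^ι]→ₗ[R] N)
    (v : ι → M) : (∑ k ∈ s, f k) v = ∑ k ∈ s, f k v :=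
  map_sum ({ toFun := fun f => f v, map_zero' := rfl, map_add' := fun _ _ => rfl } :
    (M [⋀^ι]→ₗ[R] N) →+ N) f s

namespace PolyForm

theorem dirDeriv_single {n : ℕ} (j : Fin n) (f : MvPolynomial (Fin n) ℚ) :
    dirDeriv n (Pi.single j 1) f = MvPolynomial.pderiv j f := by
  simp [dirDeriv_apply, Pi.single_apply, ite_smul]

theorem dirDeriv_centeredCoord_mul {n : ℕ} (i : Fin (n + 1)) (q : ℕ) (v : Fin n → ℚ) (j : Fin n)
    (f : MvPolynomial (Fin n) ℚ) :
    dirDeriv n v (centeredCoord i j * coneIntegral i q f) =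
      v j • coneIntegral i q f + centeredCoord i j * coneIntegral i (q + 1) (dirDeriv n v f) := by
  simp only [dirDeriv_apply, MvPolynomial.pderiv_mul, pderiv_coneIntegral, smul_add, map_sum, map_smul,
    Finset.sum_add_distrib, Finset.mul_sum, mul_smul_comm]
  congr 1
  simp [centeredCoord, MvPolynomial.pderiv_X, Pi.single_apply]

theorem d_apply {n q : ℕ} (ω : PolyForm n q) (v : Fin (q + 1) → Fin n → ℚ) :
    d q ω v = ∑ l : Fin (q + 1), (-1) ^ (l : ℕ) • dirDeriv n (v l) (ω (l.removeNth v)) := by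
  simp only [d, LinearMap.coe_mk, AddHom.coe_mk, AlternatingMap.alternatizeUncurryFin_apply]
  rfl

/-- The homotopy operator of the contraction of the simplex to a vertex. -/
def cone {n : ℕ} (i : Fin (n + 1)) (q : ℕ) : PolyForm n (q + 1) →ₗ[ℚ] PolyForm n q where
  toFun ω := ∑ j, (LinearMap.mulLeft ℚ (centeredCoord i j) ∘ₗ coneIntegral i q).compAlternatingMap
    (ω.curryLeft (Pi.single j 1))
  map_add' ω η := by ext v; simp [AlternatingMap.sum_apply, Finset.sum_add_distrib]
  map_smul' c ω := by ext v; simp [AlternatingMap.sum_apply, Finset.smul_sum]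

theorem cone_apply {n : ℕ} (i : Fin (n + 1)) (q : ℕ) (ω : PolyForm n (q + 1))
    (v : Fin q → Fin n → ℚ) : cone i q ω v =
      ∑ j, centeredCoord i j * coneIntegral i q (ω (Matrix.vecCons (Pi.single j 1) v)) := by
  simp [cone, AlternatingMap.sum_apply]

theorem sum_smul_map_vecCons {n q : ℕ} {M : Type*} [AddCommGroup M] [Module ℚ M]
    (ω : (Fin n → ℚ) [⋀^Fin (q + 1)]→ₗ[ℚ] M) (u : Fin n → ℚ) (v : Fin q → Fin n → ℚ) :
    ∑ j, u j • ω (Matrix.vecCons (Pi.single j 1) v) = ω (Matrix.vecCons u v) := by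
  have h : ω.curryLeft u v = ω.curryLeft (∑ j, u j • Pi.single j 1) v := by
    congr
    ext k
    simp [Pi.single_apply]
  simp only [map_sum, map_smul] at h
  simpa [AlternatingMap.sum_apply] using h.symm

/-- Moving `v l` back to its place costs the sign $(-1)^l$, so each of the $q+1$ terms equals `ω v`.
-/
theorem sum_neg_one_pow_smul_map_vecCons_removeNth {M N : Type*} [AddCommGroup M] [Module ℚ M]
    [AddCommGroup N] [Module ℚ N] {q : ℕ} (ω : M [⋀^Fin (q + 1)]→ₗ[ℚ] N) (v : Fin (q + 1) → M) :
    ∑ l : Fin (q + 1), (-1) ^ (l : ℕ) • ω (Matrix.vecCons (v l) (l.removeNth v)) =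
      (q + 1) • ω v := by
  have h := DFunLike.congr_fun (AlternatingMap.alternatizeUncurryFin_curryLeft ω) v
  rw [AlternatingMap.alternatizeUncurryFin_apply] at h
  exact h

theorem removeNth_succ_vecCons {M : Type*} {q : ℕ} (u : M) (v : Fin (q + 1) → M) (l : Fin (q + 1)) :
    l.succ.removeNth (Matrix.vecCons u v) = Matrix.vecCons u (l.removeNth v) := by
  ext k
  refine Fin.cases ?_ (fun k => ?_) k <;> simp [Fin.removeNth]

/-- In $d\circ$`cone`, derivatives of the centered coordinates add up to $q+1$ times the integral of
$\omega$, and derivatives of $\omega$ cancel against `cone`$\circ d$. What remains is the Euler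
identity `coneIntegral_euler`. -/
theorem d_cone_add_cone_d {n : ℕ} (i : Fin (n + 1)) (q : ℕ) (ω : PolyForm n (q + 1)) :
    d q (cone i q ω) + cone i (q + 1) (d (q + 1) ω) = ω := by
  ext1 v
  rw [AlternatingMap.add_apply, d_apply, cone_apply]
  have h1 : ∀ l : Fin (q + 1), dirDeriv n (v l) (cone i q ω (l.removeNth v)) =
      coneIntegral i q (ω (Matrix.vecCons (v l) (l.removeNth v))) + ∑ j, centeredCoord i j *
        coneIntegral i (q + 1) (dirDeriv n (v l)
          (ω (Matrix.vecCons (Pi.single j 1) (l.removeNth v)))) := by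
    intro l
    rw [cone_apply, map_sum]
    simp only [dirDeriv_centeredCoord_mul, Finset.sum_add_distrib]
    rw [← sum_smul_map_vecCons ω (v l), map_sum]
    simp only [map_smul]
  have h2 : ∀ j : Fin n, d (q + 1) ω (Matrix.vecCons (Pi.single j 1) v) =
      MvPolynomial.pderiv j (ω v) - ∑ l : Fin (q + 1), (-1) ^ (l : ℕ) •
        dirDeriv n (v l) (ω (Matrix.vecCons (Pi.single j 1) (l.removeNth v))) := by
    intro j
    rw [d_apply, Fin.sum_univ_succ, sub_eq_add_neg, ← Finset.sum_neg_distrib]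
    congr 1
    · simp [dirDeriv_single]
    · refine Finset.sum_congr rfl fun l _ => ?_
      rw [removeNth_succ_vecCons, Fin.val_succ, pow_succ, mul_neg_one, neg_smul]
      rfl
  simp only [h1, h2, smul_add, Finset.sum_add_distrib]
  have h3 := congrArg (coneIntegral i q) (sum_neg_one_pow_smul_map_vecCons_removeNth ω v)
  rw [map_sum, ← Nat.cast_smul_eq_nsmul ℚ, map_smul] at h3
  simp only [map_zsmul] at h3
  rw [h3]
  simp only [map_sub, mul_sub, Finset.sum_sub_distrib]
  have h4 : ∑ l : Fin (q + 1), (-1 : ℤ) ^ (l : ℕ) • ∑ j, centeredCoord i j * coneIntegral i (q + 1)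
        (dirDeriv n (v l) (ω (Matrix.vecCons (Pi.single j 1) (l.removeNth v)))) =
      ∑ j, centeredCoord i j * coneIntegral i (q + 1) (∑ l : Fin (q + 1), (-1 : ℤ) ^ (l : ℕ) •
        dirDeriv n (v l) (ω (Matrix.vecCons (Pi.single j 1) (l.removeNth v)))) := by
    simp only [Finset.smul_sum, map_sum, map_zsmul, Finset.mul_sum, mul_smul_comm]
    exact Finset.sum_comm
  rw [h4]
  have h5 := coneIntegral_euler i q (ω v)
  push_cast
  conv_rhs => rw [← h5]
  abel

theorem cone_d_zero {n : ℕ} (i : Fin (n + 1)) (f : PolyForm n 0) (h : d 0 f = 0) :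
    ∃ c : ℚ, ∀ v, f v = MvPolynomial.C c := by
  refine ⟨MvPolynomial.constantCoeff (uncenterAt i (f ![])), fun v => ?_⟩
  obtain rfl : v = ![] := Subsingleton.elim _ _
  have h1 := coneIntegral_euler_zero i (f ![])
  have h2 : ∀ j, MvPolynomial.pderiv j (f ![]) = 0 := by
    intro j
    have := DFunLike.congr_fun h ![Pi.single j 1]
    rw [d_apply] at this
    simp [dirDeriv_single] at this
    convert this
  simp only [h2, map_zero, mul_zero, Finset.sum_const_zero] at h1
  exact sub_eq_zero.1 h1.symm

/-- An affine map carries segments to vertex `i` to segments to vertex `α i`. The cone is natural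
only with the vertex moved along, which is why `formH` ties it to vertex data. -/
theorem pullback_cone {m n : ℕ} (α : Fin (m + 1) → Fin (n + 1)) (i : Fin (m + 1)) (q : ℕ)
    (ω : PolyForm n (q + 1)) :
    pullback α q (cone (α i) q ω) = cone i q (pullback α (q + 1) ω) := by
  ext1 v
  have hp : ∀ {q : ℕ} (ω : PolyForm n q) (v : Fin q → Fin m → ℚ),
      pullback α q ω v = pullPoly α (ω fun k => pushTangent α (v k)) := fun ω v => rfl
  rw [hp, cone_apply, cone_apply, map_sum]
  simp only [map_mul, pullPoly_centeredCoord, pullPoly_coneIntegral, Finset.sum_mul, hp]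
  rw [Finset.sum_comm]
  refine Finset.sum_congr rfl fun l _ => ?_
  simp only [smul_mul_assoc, ← mul_smul_comm]
  rw [← Finset.mul_sum]
  simp only [← map_smul]
  rw [← map_sum, ← map_sum, sum_smul_map_vecCons ω]
  congr 4
  ext k
  refine Fin.cases ?_ (fun k => ?_) k <;> simp

end PolyForm

/-! ### Forms with coefficients in alternating maps on the vertices -/

/-- The sum of the coordinates. -/
def coordSum (n : ℕ) : (Fin (n + 1) → ℚ) →ₗ[ℚ] ℚ := ∑ i, LinearMap.proj i

theorem coordSum_apply {n : ℕ} (v : Fin (n + 1) → ℚ) : coordSum n v = ∑ i, v i := by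
  simp [coordSum]

theorem coordSum_single {n : ℕ} (i : Fin (n + 1)) : coordSum n (Pi.single i 1) = 1 := by
  simp [coordSum_apply]

/-- The linear map of the spaces spanned by the vertices induced by a map of vertices. -/
def pushVertex {m n : ℕ} (α : Fin (m + 1) → Fin (n + 1)) :
    (Fin (m + 1) → ℚ) →ₗ[ℚ] (Fin (n + 1) → ℚ) where
  toFun v j := ∑ i with α i = j, v i
  map_add' v w := by ext j; simp [Finset.sum_add_distrib]
  map_smul' c v := by ext j; simp [Finset.mul_sum]

theorem pushVertex_apply {m n : ℕ} (α : Fin (m + 1) → Fin (n + 1)) (v : Fin (m + 1) → ℚ)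
    (j : Fin (n + 1)) : pushVertex α v j = ∑ i with α i = j, v i := rfl

theorem pushVertex_single {m n : ℕ} (α : Fin (m + 1) → Fin (n + 1)) (i : Fin (m + 1)) :
    pushVertex α (Pi.single i 1) = Pi.single (α i) 1 := by
  ext j
  simp [pushVertex_apply, Pi.single_apply, Finset.sum_ite_eq', eq_comm (a := j)]

theorem coordSum_pushVertex {m n : ℕ} (α : Fin (m + 1) → Fin (n + 1)) (v : Fin (m + 1) → ℚ) :
    coordSum n (pushVertex α v) = coordSum m v := by
  simp only [coordSum_apply, pushVertex_apply]
  exact Finset.sum_fiberwise _ _ _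

section Simplicial

variable {M N : Type*} [AddCommGroup M] [Module ℚ M] [AddCommGroup N] [Module ℚ N]

/-- The exterior product with the sum of the coordinates, that is, the alternating form of the
simplicial coboundary. -/
def vertexD {n r : ℕ} (F : (Fin (n + 1) → ℚ) [⋀^Fin r]→ₗ[ℚ] M) :
    (Fin (n + 1) → ℚ) [⋀^Fin (r + 1)]→ₗ[ℚ] M :=
  AlternatingMap.alternatizeUncurryFin ((coordSum n).smulRight F)

theorem vertexD_apply {n r : ℕ} (F : (Fin (n + 1) → ℚ) [⋀^Fin r]→ₗ[ℚ] M)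
    (v : Fin (r + 1) → Fin (n + 1) → ℚ) :
    vertexD F v = ∑ l : Fin (r + 1), (-1) ^ (l : ℕ) • (coordSum n (v l) • F (l.removeNth v)) := by
  rw [vertexD, AlternatingMap.alternatizeUncurryFin_apply]
  rfl

theorem vertexD_sub {n r : ℕ} (F G : (Fin (n + 1) → ℚ) [⋀^Fin r]→ₗ[ℚ] M) :
    vertexD (F - G) = vertexD F - vertexD G := by
  ext v
  simp [vertexD_apply, smul_sub, Finset.sum_sub_distrib]

theorem vertexD_compAlternatingMap {n r : ℕ} (g : M →ₗ[ℚ] N)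
    (F : (Fin (n + 1) → ℚ) [⋀^Fin r]→ₗ[ℚ] M) :
    vertexD (g.compAlternatingMap F) = g.compAlternatingMap (vertexD F) := by
  ext v
  simp [vertexD_apply]

theorem vertexD_compLinearMap {m n r : ℕ} (α : Fin (m + 1) → Fin (n + 1))
    (F : (Fin (n + 1) → ℚ) [⋀^Fin r]→ₗ[ℚ] M) :
    vertexD (F.compLinearMap (pushVertex α)) = (vertexD F).compLinearMap (pushVertex α) := by
  ext v
  simp only [vertexD_apply, AlternatingMap.compLinearMap_apply, coordSum_pushVertex]
  rfl

theorem vertexD_vertexD {n r : ℕ} (F : (Fin (n + 1) → ℚ) [⋀^Fin r]→ₗ[ℚ] M) :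
    vertexD (vertexD F) = 0 := by
  rw [← AlternatingMap.alternatizeUncurryFin_alternatizeUncurryFinLM_comp_of_symmetric
    (f := (coordSum n).smulRight ((coordSum n).smulRight F)) (by
      intro x y; simp [smul_smul, mul_comm])]
  rw [vertexD]
  congr 1
  ext v u
  simp [vertexD]

/-- The antiderivation rule for contraction with a vertex vector, on which the coordinate sum is 1.
-/
theorem vertexD_vecCons {n r : ℕ} (F : (Fin (n + 1) → ℚ) [⋀^Fin (r + 1)]→ₗ[ℚ] M)
    (i : Fin (n + 1)) (v : Fin (r + 1) → Fin (n + 1) → ℚ) :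
    vertexD F (Matrix.vecCons (Pi.single i 1) v) =
      F v - vertexD (F.curryLeft (Pi.single i 1)) v := by
  rw [vertexD_apply, Fin.sum_univ_succ, vertexD_apply, sub_eq_add_neg, ← Finset.sum_neg_distrib]
  congr 1
  · simp [coordSum_single]
  · refine Finset.sum_congr rfl fun l _ => ?_
    rw [PolyForm.removeNth_succ_vecCons, Fin.val_succ, pow_succ, mul_neg_one, neg_smul]
    rfl

end Simplicial

/-- Forms on the simplex with values in the alternating maps on the space spanned by the
vertices. -/
abbrev VertexForm (n r q : ℕ) : Type := (Fin (n + 1) → ℚ) [⋀^Fin r]→ₗ[ℚ] PolyForm n q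

namespace PolyForm

/-- The multiplication of forms by a barycentric coordinate. -/
def mulBary {n : ℕ} (i : Fin (n + 1)) (q : ℕ) : PolyForm n q →ₗ[ℚ] PolyForm n q where
  toFun ω := (LinearMap.mulLeft ℚ (baryCoord n i)).compAlternatingMap ω
  map_add' ω η := by ext v; simp
  map_smul' c ω := by ext v; simp

theorem mulBary_apply {n : ℕ} (i : Fin (n + 1)) (q : ℕ) (ω : PolyForm n q)
    (v : Fin q → Fin n → ℚ) : mulBary i q ω v = baryCoord n i * ω v := rfl

theorem sum_mulBary {n q : ℕ} (ω : PolyForm n q) : ∑ i, mulBary i q ω = ω := by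
  ext1 v
  simp only [AlternatingMap.sum_apply, mulBary_apply]
  rw [← Finset.sum_mul, sum_baryCoord, one_mul]

theorem pullback_apply {m n q : ℕ} (α : Fin (m + 1) → Fin (n + 1)) (ω : PolyForm n q)
    (v : Fin q → Fin m → ℚ) :
    pullback α q ω v = pullPoly α (ω fun k => pushTangent α (v k)) := rfl

theorem pullback_mulBary {m n q : ℕ} (α : Fin (m + 1) → Fin (n + 1)) (j : Fin (n + 1))
    (ω : PolyForm n q) :
    pullback α q (mulBary j q ω) = ∑ i with α i = j, mulBary i q (pullback α q ω) := by
  ext1 v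
  rw [pullback_apply, mulBary_apply, map_mul, pullPoly_baryCoord, Finset.sum_mul,
    AlternatingMap.sum_apply]
  rfl

end PolyForm

namespace VertexForm

open PolyForm

/-- The exterior derivative of the values. -/
def formD {n r q : ℕ} (F : VertexForm n r q) : VertexForm n r (q + 1) :=
  (PolyForm.d q).compAlternatingMap F

theorem formD_formD {n r q : ℕ} (F : VertexForm n r q) : formD (formD F) = 0 := by
  ext1 v
  exact PolyForm.d_d (F v)

theorem formD_vertexD {n r q : ℕ} (F : VertexForm n r q) :
    formD (vertexD F) = vertexD (formD F) :=
  (vertexD_compAlternatingMap _ _).symm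

theorem formD_sub {n r q : ℕ} (F G : VertexForm n r q) : formD (F - G) = formD F - formD G := by
  ext1 v
  exact map_sub (PolyForm.d q) _ _

/-- The pullback along a map of simplices. -/
def pull {m n r q : ℕ} (α : Fin (m + 1) → Fin (n + 1)) (F : VertexForm n r q) :
    VertexForm m r q :=
  (PolyForm.pullback α q).compAlternatingMap (F.compLinearMap (pushVertex α))

theorem pull_apply {m n r q : ℕ} (α : Fin (m + 1) → Fin (n + 1)) (F : VertexForm n r q)
    (v : Fin r → Fin (m + 1) → ℚ) :
    pull α F v = PolyForm.pullback α q (F fun k => pushVertex α (v k)) := rfl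

theorem pull_sub {m n r q : ℕ} (α : Fin (m + 1) → Fin (n + 1)) (F G : VertexForm n r q) :
    pull α (F - G) = pull α F - pull α G := by
  ext1 v
  exact map_sub (PolyForm.pullback α q) _ _

theorem pull_formD {m n r q : ℕ} (α : Fin (m + 1) → Fin (n + 1)) (F : VertexForm n r q) :
    formD (pull α F) = pull α (formD F) := by
  ext1 v
  exact PolyForm.d_pullback α _

theorem pull_vertexD {m n r q : ℕ} (α : Fin (m + 1) → Fin (n + 1)) (F : VertexForm n r q) :
    vertexD (pull α F) = pull α (vertexD F) := by
  rw [pull, vertexD_compAlternatingMap, vertexD_compLinearMap]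
  rfl

/-- The contracting homotopy of `vertexD`. -/
def vertexH {n r q : ℕ} (F : VertexForm n (r + 1) q) : VertexForm n r q :=
  ∑ i, (mulBary i q).compAlternatingMap (F.curryLeft (Pi.single i 1))

theorem vertexH_apply {n r q : ℕ} (F : VertexForm n (r + 1) q) (v : Fin r → Fin (n + 1) → ℚ) :
    vertexH F v = ∑ i, mulBary i q (F (Matrix.vecCons (Pi.single i 1) v)) := by
  simp [vertexH, AlternatingMap.sum_apply]

theorem vertexH_vertexD_zero {n q : ℕ} (F : VertexForm n 0 q) : vertexH (vertexD F) = F := by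
  ext1 v
  rw [vertexH_apply]
  have h : ∀ i : Fin (n + 1), vertexD F (Matrix.vecCons (Pi.single i 1) v) = F v := by
    intro i
    rw [vertexD_apply, Fin.sum_univ_succ, Finset.univ_eq_empty, Finset.sum_empty, add_zero,
      Subsingleton.elim v (Fin.removeNth 0 (Matrix.vecCons (Pi.single i 1) v))]
    simp [coordSum_single]
  simp only [h, sum_mulBary]

/-- `vertexH` contracts with $\sum_i t_ie_i$, whose coordinate sum is 1; this is the Koszul
homotopy. -/
theorem vertexH_vertexD {n r q : ℕ} (F : VertexForm n (r + 1) q) :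
    vertexH (vertexD F) = F - vertexD (vertexH F) := by
  ext1 v
  rw [vertexH_apply, AlternatingMap.sub_apply]
  simp only [vertexD_vecCons, map_sub, Finset.sum_sub_distrib, sum_mulBary]
  congr 1
  rw [vertexD_apply]
  simp only [vertexH_apply, vertexD_apply, map_sum, map_smul, map_zsmul, Finset.smul_sum]
  rw [Finset.sum_comm]
  rfl

theorem vertexH_pull {m n r q : ℕ} (α : Fin (m + 1) → Fin (n + 1)) (F : VertexForm n (r + 1) q) :
    vertexH (pull α F) = pull α (vertexH F) := by
  ext1 v
  rw [pull_apply, vertexH_apply, vertexH_apply, map_sum]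
  simp only [pullback_mulBary]
  rw [← Finset.sum_fiberwise (s := Finset.univ) (g := α)]
  refine Finset.sum_congr rfl fun j _ => Finset.sum_congr rfl fun i hi => ?_
  rw [pull_apply]
  congr 3
  ext1 k
  rw [Finset.mem_filter] at hi
  refine Fin.cases ?_ (fun k => ?_) k
  · simp [pushVertex_single, hi.2]
  · simp

/-- The exterior product of a coordinate with the contraction with a vertex. -/
def vertexProj {n r q : ℕ} (i : Fin (n + 1)) (F : VertexForm n (r + 1) q) :
    VertexForm n (r + 1) q :=
  AlternatingMap.alternatizeUncurryFin
    ((LinearMap.proj i : (Fin (n + 1) → ℚ) →ₗ[ℚ] ℚ).smulRight (F.curryLeft (Pi.single i 1)))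

theorem vertexProj_apply {n r q : ℕ} (i : Fin (n + 1)) (F : VertexForm n (r + 1) q)
    (v : Fin (r + 1) → Fin (n + 1) → ℚ) : vertexProj i F v =
      ∑ l : Fin (r + 1), (-1) ^ (l : ℕ) • (v l i • F (Matrix.vecCons (Pi.single i 1) (l.removeNth v))) := by
  rw [vertexProj, AlternatingMap.alternatizeUncurryFin_apply]
  rfl

/-- The operator $\sum_i e_i^*\wedge\iota_{e_i}$ multiplies by the exterior degree; hence the factor
$1/(r+1)$ in `formH`. -/
theorem sum_vertexProj {n r q : ℕ} (F : VertexForm n (r + 1) q) :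
    ∑ i, vertexProj i F = (r + 1) • F := by
  ext1 v
  rw [AlternatingMap.sum_apply]
  simp only [vertexProj_apply]
  rw [Finset.sum_comm]
  simp only [← Finset.smul_sum]
  simp only [sum_smul_map_vecCons F]
  exact sum_neg_one_pow_smul_map_vecCons_removeNth F v

theorem vertexProj_formD {n r q : ℕ} (i : Fin (n + 1)) (F : VertexForm n (r + 1) q) :
    vertexProj i (formD F) = formD (vertexProj i F) := by
  ext1 v
  change _ = PolyForm.d q (vertexProj i F v)
  rw [vertexProj_apply, vertexProj_apply, map_sum]
  simp only [map_zsmul, map_smul]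
  rfl

/-- The contracting homotopy of `formD` in positive degrees. -/
def formH {n r q : ℕ} (F : VertexForm n (r + 1) (q + 1)) : VertexForm n (r + 1) q :=
  (1 / (r + 1) : ℚ) • ∑ i, (cone i q).compAlternatingMap (vertexProj i F)

theorem formH_apply {n r q : ℕ} (F : VertexForm n (r + 1) (q + 1))
    (v : Fin (r + 1) → Fin (n + 1) → ℚ) :
    formH F v = (1 / (r + 1) : ℚ) • ∑ i, cone i q (vertexProj i F v) := by
  simp [formH, AlternatingMap.sum_apply]

/-- `vertexProj` acts on the vertex variables only, so each component stays closed and is integrated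
by the cone to its own vertex. -/
theorem formD_formH {n r q : ℕ} (F : VertexForm n (r + 1) (q + 1)) (hF : formD F = 0) :
    formD (formH F) = F := by
  ext1 v
  change PolyForm.d q (formH F v) = _
  have h : ∀ i : Fin (n + 1), PolyForm.d q (cone i q (vertexProj i F v)) = vertexProj i F v := by
    intro i
    have h1 := d_cone_add_cone_d i q (vertexProj i F v)
    have h2 : PolyForm.d (q + 1) (vertexProj i F v) = 0 := by
      change formD (vertexProj i F) v = 0
      rw [← vertexProj_formD, hF, vertexProj_apply]
      simp
    rwa [h2, map_zero, add_zero] at h1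
  rw [formH_apply, map_smul, map_sum]
  simp only [h]
  rw [← AlternatingMap.sum_apply, sum_vertexProj, AlternatingMap.smul_apply,
    ← Nat.cast_smul_eq_nsmul ℚ, smul_smul]
  have : (r + 1 : ℚ) ≠ 0 := by positivity
  push_cast
  rw [one_div, inv_mul_cancel₀ this, one_smul]

theorem formH_pull {m n r q : ℕ} (α : Fin (m + 1) → Fin (n + 1))
    (F : VertexForm n (r + 1) (q + 1)) : formH (pull α F) = pull α (formH F) := by
  ext1 v
  rw [pull_apply, formH_apply, formH_apply, map_smul, map_sum]
  congr 1
  have h : ∀ i : Fin (m + 1), vertexProj i (pull α F) v = PolyForm.pullback α (q + 1)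
      (∑ l : Fin (r + 1), (-1) ^ (l : ℕ) • (v l i • F (Matrix.vecCons (Pi.single (α i) 1)
        (l.removeNth fun k => pushVertex α (v k))))) := by
    intro i
    rw [vertexProj_apply, map_sum]
    refine Finset.sum_congr rfl fun l _ => ?_
    rw [map_zsmul, map_smul, pull_apply]
    congr 4
    ext1 k
    refine Fin.cases ?_ (fun k => ?_) k
    · simp [pushVertex_single]
    · simp [Fin.removeNth]
  simp only [h, ← pullback_cone, ← map_sum]
  congr 1
  -- Vertices with the same image `j` share a cone, and their coefficients sum to the `j`-th
  -- coordinate of the pushed vector. Vertices outside the image contribute nothing.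
  rw [← Finset.sum_fiberwise (s := Finset.univ) (g := α)]
  refine Finset.sum_congr rfl fun j _ => ?_
  have h2 : ∀ i ∈ Finset.univ.filter (fun i => α i = j), cone (α i) q (∑ l : Fin (r + 1), (-1) ^ (l : ℕ) • (v l i •
      F (Matrix.vecCons (Pi.single (α i) 1) (l.removeNth fun k => pushVertex α (v k))))) =
      cone j q (∑ l : Fin (r + 1), (-1) ^ (l : ℕ) • (v l i •
      F (Matrix.vecCons (Pi.single j 1) (l.removeNth fun k => pushVertex α (v k))))) := by
    intro i hi
    rw [(Finset.mem_filter.1 hi).2]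
  rw [Finset.sum_congr rfl h2, ← map_sum, vertexProj_apply, Finset.sum_comm]
  simp only [← Finset.smul_sum, ← Finset.sum_smul, pushVertex_apply]

end VertexForm

/-! ### The zigzag in the double complex. -/

namespace VertexForm

variable {K : SSet.{u}}

/-- Compatibility of a family of forms on the simplices of a simplicial set with the simplicial
operators. -/
def IsNatural {r q : ℕ} (F : ∀ n, K _⦋n⦌ → VertexForm n r q) : Prop :=
  ∀ (m n : ℕ) (α : ⦋m⦌ ⟶ ⦋n⦌) (σ : K _⦋n⦌),
    F m (K.map α.op σ) = pull (SimplexCategory.Hom.toOrderHom α) (F n σ)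

/-- Compatibility of a family of alternating maps on the vertices of the simplices of a simplicial
set with the simplicial operators. -/
def IsNaturalCochain {r : ℕ} (c : ∀ n, K _⦋n⦌ → (Fin (n + 1) → ℚ) [⋀^Fin r]→ₗ[ℚ] ℚ) : Prop :=
  ∀ (m n : ℕ) (α : ⦋m⦌ ⟶ ⦋n⦌) (σ : K _⦋n⦌),
    c m (K.map α.op σ) = (c n σ).compLinearMap (pushVertex (SimplexCategory.Hom.toOrderHom α))

/-- The constant functions as forms. -/
def constForm (n : ℕ) : ℚ →ₗ[ℚ] PolyForm n 0 where
  toFun c := AlternatingMap.constOfIsEmpty ℚ (Fin n → ℚ) (Fin 0) (MvPolynomial.C c)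
  map_add' a b := by ext v; simp
  map_smul' a b := by ext v; simp [MvPolynomial.smul_eq_C_mul]

/-- The constant coefficients of functions. -/
def constPart (n : ℕ) : PolyForm n 0 →ₗ[ℚ] ℚ where
  toFun f := MvPolynomial.constantCoeff (f ![])
  map_add' f g := by simp
  map_smul' a f := by simp [MvPolynomial.smul_eq_C_mul]

theorem constPart_constForm {n : ℕ} (c : ℚ) : constPart n (constForm n c) = c := by
  simp [constPart, constForm]

theorem d_constForm {n : ℕ} (c : ℚ) : PolyForm.d 0 (constForm n c) = 0 := by
  ext1 v
  rw [PolyForm.d_apply]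
  simp [constForm, PolyForm.dirDeriv_apply]

theorem pullback_constForm {m n : ℕ} (α : Fin (m + 1) → Fin (n + 1)) (c : ℚ) :
    PolyForm.pullback α 0 (constForm n c) = constForm m c := by
  ext1 v
  rw [PolyForm.pullback_apply]
  simp [constForm, pullPoly]

theorem constForm_constPart {n : ℕ} (f : PolyForm n 0) (hf : PolyForm.d 0 f = 0) :
    constForm n (constPart n f) = f := by
  obtain ⟨c, hc⟩ := PolyForm.cone_d_zero 0 f hf
  ext1 v
  simp [constForm, constPart, hc]

/-- If the alternating cochains of a simplicial set have no cohomology in degree `k`, a natural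
family `η` with closed coboundary has the coboundary of a closed family. -/
theorem exists_closed_vertexD_eq (k : ℕ)
    (hK : ∀ c : ∀ n, K _⦋n⦌ → (Fin (n + 1) → ℚ) [⋀^Fin (k + 1)]→ₗ[ℚ] ℚ, IsNaturalCochain c →
      (∀ n σ, vertexD (c n σ) = 0) → ∃ b : ∀ n, K _⦋n⦌ → (Fin (n + 1) → ℚ) [⋀^Fin k]→ₗ[ℚ] ℚ,
        IsNaturalCochain b ∧ ∀ n σ, vertexD (b n σ) = c n σ)
    (η : ∀ n, K _⦋n⦌ → VertexForm n k 0) (hη : IsNatural η)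
    (hd : ∀ n σ, formD (vertexD (η n σ)) = 0) :
    ∃ b : ∀ n, K _⦋n⦌ → VertexForm n k 0, IsNatural b ∧ (∀ n σ, formD (b n σ) = 0) ∧
      ∀ n σ, vertexD (b n σ) = vertexD (η n σ) := by
  let c : ∀ n, K _⦋n⦌ → (Fin (n + 1) → ℚ) [⋀^Fin (k + 1)]→ₗ[ℚ] ℚ := fun n σ =>
    (constPart n).compAlternatingMap (vertexD (η n σ))
  -- Closed functions on a simplex are constant, so `vertexD η` is a rational cochain.
  have hc : ∀ n σ, (constForm n).compAlternatingMap (c n σ) = vertexD (η n σ) := fun n σ => by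
    ext1 v
    exact constForm_constPart _ (DFunLike.congr_fun (hd n σ) v)
  obtain ⟨b, hb, hbc⟩ := hK c (fun m n α σ => by
    ext1 v
    change constPart m (vertexD (η m (K.map α.op σ)) v) = c n σ _
    rw [hη m n α σ, pull_vertexD, pull_apply, ← hc n σ]
    change constPart m (PolyForm.pullback _ 0 (constForm n (c n σ _))) = _
    rw [pullback_constForm, constPart_constForm]) (fun n σ => by
    rw [vertexD_compAlternatingMap, vertexD_vertexD]
    ext1 v
    exact map_zero (constPart n))
  refine ⟨fun n σ => (constForm n).compAlternatingMap (b n σ), fun m n α σ => ?_, fun n σ => ?_,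
    fun n σ => ?_⟩
  · ext1 v
    dsimp only
    rw [hb m n α σ, pull_apply]
    exact (pullback_constForm _ _).symm
  · ext1 v
    exact d_constForm _
  · rw [vertexD_compAlternatingMap, hbc, hc]

/-- One step of the zigzag: integrate `vertexD η` to $\zeta$ with `formH`, use `hr` to correct
$\zeta$ by a `formD`-closed family so that it becomes `vertexD`-closed, and integrate the result
with `vertexH`. -/
theorem exists_vertexD_formD_eq {r q : ℕ} (hr : ∀ η : ∀ n, K _⦋n⦌ → VertexForm n (r + 1) q,
      IsNatural η → (∀ n σ, formD (vertexD (η n σ)) = 0) →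
      ∃ b : ∀ n, K _⦋n⦌ → VertexForm n (r + 1) q, IsNatural b ∧ (∀ n σ, formD (b n σ) = 0) ∧
        ∀ n σ, vertexD (b n σ) = vertexD (η n σ))
    (η : ∀ n, K _⦋n⦌ → VertexForm n r (q + 1)) (hη : IsNatural η)
    (hd : ∀ n σ, formD (vertexD (η n σ)) = 0) :
    ∃ μ : ∀ n, K _⦋n⦌ → VertexForm n r q, IsNatural μ ∧
      ∀ n σ, vertexD (formD (μ n σ)) = vertexD (η n σ) := by
  have h1 : ∀ n σ, formD (formH (vertexD (η n σ))) = vertexD (η n σ) := fun n σ =>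
    formD_formH _ (hd n σ)
  have h2 : IsNatural fun n σ => formH (vertexD (η n σ)) := fun m n α σ => by
    simp only [hη m n α σ, pull_vertexD, formH_pull]
  obtain ⟨b, hb, hbd, hbη⟩ := hr (fun n σ => formH (vertexD (η n σ))) h2 (fun n σ => by
    rw [formD_vertexD, h1, vertexD_vertexD])
  refine ⟨fun n σ => vertexH (formH (vertexD (η n σ)) - b n σ), fun m n α σ => ?_, fun n σ => ?_⟩
  · have := h2 m n α σ
    simp only at this
    simp only [this, hb m n α σ, ← pull_sub, vertexH_pull]
  · have h3 := vertexH_vertexD (formH (vertexD (η n σ)) - b n σ)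
    have h4 : vertexD (formH (vertexD (η n σ)) - b n σ) = 0 := by
      rw [vertexD_sub, hbη]
      ext1 v
      rw [AlternatingMap.sub_apply, AlternatingMap.zero_apply]
      exact sub_eq_zero.2 rfl
    have h5 : vertexH (0 : VertexForm n (r + 1 + 1) q) = 0 := by
      ext1 v
      simp [vertexH_apply]
    rw [h4, h5] at h3
    have h6 : vertexD (vertexH (formH (vertexD (η n σ)) - b n σ)) =
        formH (vertexD (η n σ)) - b n σ := by
      ext1 v
      have h7 := DFunLike.congr_fun h3 v
      rw [AlternatingMap.sub_apply, AlternatingMap.zero_apply] at h7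
      exact (sub_eq_zero.1 h7.symm).symm
    rw [← formD_vertexD, h6, formD_sub, h1, hbd]
    ext1 v
    rw [AlternatingMap.sub_apply, AlternatingMap.zero_apply]
    exact sub_eq_self.2 rfl

/-- Induction along the antidiagonal $r+q=k$ from the corner $q=0$, where the cohomology of the
cochains enters. -/
theorem exists_closed_vertexD_eq_of_add_eq (k : ℕ)
    (hK : ∀ c : ∀ n, K _⦋n⦌ → (Fin (n + 1) → ℚ) [⋀^Fin (k + 1)]→ₗ[ℚ] ℚ, IsNaturalCochain c →
      (∀ n σ, vertexD (c n σ) = 0) → ∃ b : ∀ n, K _⦋n⦌ → (Fin (n + 1) → ℚ) [⋀^Fin k]→ₗ[ℚ] ℚ,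
        IsNaturalCochain b ∧ ∀ n σ, vertexD (b n σ) = c n σ) (q : ℕ) :
    ∀ r, r + q = k → ∀ η : ∀ n, K _⦋n⦌ → VertexForm n r q, IsNatural η →
      (∀ n σ, formD (vertexD (η n σ)) = 0) →
      ∃ b : ∀ n, K _⦋n⦌ → VertexForm n r q, IsNatural b ∧ (∀ n σ, formD (b n σ) = 0) ∧
        ∀ n σ, vertexD (b n σ) = vertexD (η n σ) := by
  induction q with
  | zero =>
    rintro r rfl
    exact exists_closed_vertexD_eq r hK
  | succ q ih =>
    intro r hr η hη hd
    obtain ⟨μ, hμ, hμη⟩ := exists_vertexD_formD_eq (ih (r + 1) (by omega)) η hη hd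
    exact ⟨fun n σ => formD (μ n σ), fun m n α σ => by dsimp only; rw [hμ m n α σ, pull_formD],
      fun n σ => formD_formD _, hμη⟩

end VertexForm

open VertexForm in
/-- Closed polynomial forms on a simplicial set are exact in the degrees in which the alternating
cochains have no cohomology. -/
theorem SSet.exists_polyFormsD_eq (K : SSet.{u}) (k : ℕ)
    (hK : ∀ c : ∀ n, K _⦋n⦌ → (Fin (n + 1) → ℚ) [⋀^Fin (k + 2)]→ₗ[ℚ] ℚ, IsNaturalCochain c →
      (∀ n σ, vertexD (c n σ) = 0) →
      ∃ b : ∀ n, K _⦋n⦌ → (Fin (n + 1) → ℚ) [⋀^Fin (k + 1)]→ₗ[ℚ] ℚ,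
        IsNaturalCochain b ∧ ∀ n σ, vertexD (b n σ) = c n σ)
    (Φ : K.polyForms (k + 1)) (hΦ : K.polyFormsD (k + 1) Φ = 0) :
    ∃ Ψ : K.polyForms k, K.polyFormsD k Ψ = Φ := by
  have hd : ∀ n σ, PolyForm.d (k + 1) (Φ.1 n σ) = 0 := fun n σ =>
    congrFun (congrFun (congrArg Subtype.val hΦ) n) σ
  -- The form is placed in the column $r=0$, where `formH` is not available; `vertexD` moves it to
  -- $r=1$.
  obtain ⟨μ, hμ, h⟩ := exists_vertexD_formD_eq
    (exists_closed_vertexD_eq_of_add_eq (k + 1) hK k 1 (by omega))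
    (fun n σ => AlternatingMap.constOfIsEmpty ℚ (Fin (n + 1) → ℚ) (Fin 0) (Φ.1 n σ))
    (fun m n α σ => by
      ext1 v
      exact Φ.2 m n α σ) (fun n σ => by
      rw [formD_vertexD]
      have : formD (AlternatingMap.constOfIsEmpty ℚ (Fin (n + 1) → ℚ) (Fin 0) (Φ.1 n σ)) = 0 := by
        ext1 v
        exact hd n σ
      rw [this]
      ext1 v
      simp [vertexD_apply])
  refine ⟨⟨fun n σ => μ n σ ![], fun m n α σ => ?_⟩, ?_⟩
  · change μ m (K.map α.op σ) ![] = _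
    rw [hμ m n α σ, pull_apply]
    congr 2
    exact Subsingleton.elim _ _
  · ext1
    funext n σ
    have h1 := congrArg vertexH (h n σ)
    rw [vertexH_vertexD_zero, vertexH_vertexD_zero] at h1
    exact DFunLike.congr_fun h1 ![]

/-! ### Alternating cochains -/

/-- Alternating maps agree if they agree on the increasing sequences of basis vectors. -/
theorem AlternatingMap.ext_strictMono {r n : ℕ} {M : Type*} [AddCommGroup M] [Module ℚ M]
    {F G : (Fin n → ℚ) [⋀^Fin r]→ₗ[ℚ] M}
    (h : ∀ J : Fin r → Fin n, StrictMono J →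
      F (fun l => Pi.single (J l) 1) = G (fun l => Pi.single (J l) 1)) : F = G := by
  refine Module.Basis.ext_alternating (Pi.basisFun ℚ (Fin n)) fun v hv => ?_
  simp only [Pi.basisFun_apply]
  have hs : StrictMono (v ∘ Tuple.sort v) :=
    (Tuple.monotone_sort v).strictMono_of_injective (hv.comp (Tuple.sort v).injective)
  have h1 := h _ hs
  have h2 : ∀ F : (Fin n → ℚ) [⋀^Fin r]→ₗ[ℚ] M,
      F (fun l => Pi.single ((v ∘ Tuple.sort v) l) 1) =
        Equiv.Perm.sign (Tuple.sort v) • F (fun l => Pi.single (v l) 1) := fun F =>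
    F.map_perm (fun l => Pi.single (v l) (1 : ℚ)) (Tuple.sort v)
  rw [h2, h2] at h1
  exact smul_left_cancel _ h1

/-- The alternating map whose values on a permutation of the basis vectors `J` are signs. -/
def minorForm {r n : ℕ} (J : Fin r → Fin n) : (Fin n → ℚ) [⋀^Fin r]→ₗ[ℚ] ℚ :=
  ((MultilinearMap.mkPiAlgebra ℚ (Fin r) ℚ).compLinearMap fun l =>
    (LinearMap.proj (J l) : (Fin n → ℚ) →ₗ[ℚ] ℚ)).alternatization

theorem minorForm_apply {r n : ℕ} {J I : Fin r → Fin n} (hJ : StrictMono J) (hI : StrictMono I) :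
    minorForm J (fun l => Pi.single (I l) 1) = if I = J then 1 else 0 := by
  rw [minorForm, MultilinearMap.alternatization_apply, Finset.sum_eq_single 1]
  · simp only [Equiv.Perm.sign_one, one_smul, Equiv.Perm.coe_one, MultilinearMap.domDomCongr_apply,
      MultilinearMap.compLinearMap_apply, MultilinearMap.mkPiAlgebra_apply, LinearMap.proj_apply, id]
    split_ifs with h
    · subst h; simp
    · obtain ⟨l, hl⟩ := Function.ne_iff.1 h
      exact Finset.prod_eq_zero (Finset.mem_univ l) (by simp [Ne.symm hl])
  · intro π _ hπ
    simp only [MultilinearMap.domDomCongr_apply,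
      MultilinearMap.compLinearMap_apply, MultilinearMap.mkPiAlgebra_apply, LinearMap.proj_apply]
    suffices h : ∃ l, J l ≠ I (π l) by
      obtain ⟨l, hl⟩ := h
      rw [Finset.prod_eq_zero (Finset.mem_univ l) (by simp [hl]), smul_zero]
    by_contra hcon
    push Not at hcon
    refine hπ ?_
    -- A strictly increasing permutation is the identity, so only the diagonal term survives.
    have hm : StrictMono π := fun a b hab => by
      have := hJ hab
      rw [hcon, hcon] at this
      exact hI.lt_iff_lt.1 this
    ext l
    have := Subsingleton.elim (hm.orderIsoOfSurjective _ π.surjective) (OrderIso.refl _)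
    exact congrArg Fin.val (DFunLike.congr_fun this l)
  · simp

theorem AlternatingMap.exists_apply_strictMono {r n : ℕ} (φ : (Fin r → Fin n) → ℚ) :
    ∃ F : (Fin n → ℚ) [⋀^Fin r]→ₗ[ℚ] ℚ, ∀ J : Fin r → Fin n, StrictMono J →
      F (fun l => Pi.single (J l) 1) = φ J := by
  classical
  refine ⟨∑ J with StrictMono J, φ J • minorForm J, fun I hI => ?_⟩
  rw [AlternatingMap.sum_apply, Finset.sum_eq_single I]
  · simp [minorForm_apply hI hI]
  · intro J hJ hJI
    simp [minorForm_apply (Finset.mem_filter.1 hJ).2 hI, hJI.symm]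
  · intro h
    simp [hI] at h

/-- A rational cochain of a simplicial set that vanishes on degenerate simplices. -/
def SSet.IsNormalized {K : SSet.{u}} {p : ℕ} (f : K _⦋p⦌ → ℚ) : Prop :=
  ∀ (n : ℕ) (θ : ⦋p⦌ ⟶ ⦋n⦌), ¬Mono θ → ∀ τ : K _⦋n⦌, f (K.map θ.op τ) = 0

open AlgebraicTopology DoldKan in
/-- A normalized coboundary is the coboundary of a normalized cochain. -/
theorem SSet.exists_isNormalized (K : SSet.{u}) (p : ℕ) (g : K _⦋p⦌ → ℚ)
    (hg : IsNormalized fun σ : K _⦋p + 1⦌ => ∑ i : Fin (p + 2), (-1 : ℚ) ^ (i : ℕ) * g (K.δ i σ)) :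
    ∃ g' : K _⦋p⦌ → ℚ, IsNormalized g' ∧
      ∀ σ : K _⦋p + 1⦌, ∑ i : Fin (p + 2), (-1 : ℚ) ^ (i : ℕ) * g' (K.δ i σ) =
        ∑ i : Fin (p + 2), (-1 : ℚ) ^ (i : ℕ) * g (K.δ i σ) := by
  -- Cochains form a simplicial object of the opposite category, so the Dold–Kan projector `PInfty`
  -- gives a cochain map onto normalized cochains.
  let Y : SimplicialObject (ModuleCat.{u} ℚ)ᵒᵖ := (ratCosimplicial K).op
  have hmap : ∀ {a b : ℕ} (θ : ⦋a⦌ ⟶ ⦋b⦌) (f : K _⦋a⦌ → ℚ) (τ : K _⦋b⦌),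
      (Y.map θ.op).unop.hom f τ = f (K.map θ.op τ) := fun θ f τ => rfl
  let P (n : ℕ) : (K _⦋n⦌ → ℚ) →ₗ[ℚ] (K _⦋n⦌ → ℚ) := ((PInfty (X := Y)).f n).unop.hom
  let D : (K _⦋p⦌ → ℚ) →ₗ[ℚ] (K _⦋p + 1⦌ → ℚ) := (AlternatingFaceMapComplex.objD Y p).unop.hom
  have hD : D = ∑ i : Fin (p + 2), (-1 : ℤ) ^ (i : ℕ) • LinearMap.funLeft ℚ ℚ (K.δ i) := by
    simp only [D, AlternatingFaceMapComplex.objD, unop_sum, unop_zsmul, ModuleCat.hom_sum,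
      ModuleCat.hom_zsmul]
    rfl
  have hd : ∀ (f : K _⦋p⦌ → ℚ) (σ : K _⦋p + 1⦌),
      D f σ = ∑ i : Fin (p + 2), (-1 : ℚ) ^ (i : ℕ) * f (K.δ i σ) := by
    intro f σ
    rw [hD]
    simp [LinearMap.sum_apply, LinearMap.funLeft_apply]
  have hcomm : ∀ f : K _⦋p⦌ → ℚ, P (p + 1) (D f) = D (P p f) := by
    intro f
    have h := (PInfty (X := Y)).comm (p + 1) p
    rw [AlternatingFaceMapComplex.obj_d_eq] at h
    exact congrArg (fun φ => φ.unop.hom f) h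
  have hdeg : ∀ (n : ℕ) (f : K _⦋n⦌ → ℚ), IsNormalized (P n f) := by
    intro n f m θ hθ τ
    have h := degeneracy_comp_PInfty Y n θ hθ
    exact congrFun (congrArg (fun φ => φ.unop.hom f) h) τ
  have hid : ∀ f : K _⦋p + 1⦌ → ℚ, IsNormalized f → P (p + 1) f = f := by
    intro f hf
    -- The cochain `f` is encoded as a morphism, so that vanishing on degeneracies becomes vanishing
    -- of the complementary projector `QInfty` on it.
    let φ : Y _⦋p + 1⦌ ⟶ op (ModuleCat.of ℚ (ULift.{u} ℚ)) :=
      (ModuleCat.ofHom (LinearMap.toSpanSingleton ℚ (K _⦋p + 1⦌ → ℚ) f ∘ₗ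
        (ULift.moduleEquiv : ULift.{u} ℚ ≃ₗ[ℚ] ℚ).toLinearMap)).op
    have hφ : DegeneraciesVanish φ := by
      intro i
      refine Quiver.Hom.unop_inj (ModuleCat.hom_ext (LinearMap.ext fun a => funext fun τ => ?_))
      change a.down * f (K.map (SimplexCategory.σ i).op τ) = 0
      rw [hf p (SimplexCategory.σ i) (by
        rw [SimplexCategory.mono_iff_injective]
        intro h
        have := Fintype.card_le_of_injective _ h
        simp at this) τ, mul_zero]
    rw [degeneraciesVanish_iff_QInfty_f_comp] at hφ
    have h := PInfty_f_add_QInfty_f (X := Y) (p + 1) =≫ φ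
    rw [Category.id_comp, Preadditive.add_comp, hφ, add_zero] at h
    have h' : P (p + 1) ((1 : ℚ) • f) = (1 : ℚ) • f := congrArg (fun φ => φ.unop.hom (ULift.up 1)) h
    simpa using h'
  refine ⟨P p g, hdeg p g, fun σ => ?_⟩
  rw [← hd, ← hd, ← hcomm, hid]
  rwa [show D g = fun σ => _ from funext (hd g)]

/-- A sequence of vertices of an increasing map of simplices. -/
theorem pushVertex_comp_single {m n r : ℕ} (α : Fin (m + 1) → Fin (n + 1))
    (J : Fin r → Fin (m + 1)) : (fun l => pushVertex α (Pi.single (J l) 1)) =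
      fun l => Pi.single (α (J l)) 1 :=
  funext fun _ => pushVertex_single _ _

theorem vertexD_single {n r : ℕ} (F : (Fin (n + 1) → ℚ) [⋀^Fin r]→ₗ[ℚ] ℚ)
    (J : Fin (r + 1) → Fin (n + 1)) : vertexD F (fun l => Pi.single (J l) 1) =
      ∑ i : Fin (r + 1), (-1 : ℚ) ^ (i : ℕ) * F (fun l => Pi.single (J (i.succAbove l)) 1) := by
  rw [vertexD_apply]
  refine Finset.sum_congr rfl fun i _ => ?_
  simp only [coordSum_single, one_smul, zsmul_eq_mul]
  push_cast
  rfl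

open VertexForm in
/-- The alternating cochains of a simplicial set have no cohomology where its cochains have none. -/
theorem SSet.exists_isNaturalCochain (K : SSet.{u}) (p : ℕ)
    (hK : ∀ f : K _⦋p + 1⦌ → ℚ,
      (∀ σ : K _⦋p + 2⦌, ∑ i : Fin (p + 3), (-1 : ℚ) ^ (i : ℕ) * f (K.δ i σ) = 0) →
      ∃ g : K _⦋p⦌ → ℚ, ∀ σ, ∑ i : Fin (p + 2), (-1 : ℚ) ^ (i : ℕ) * g (K.δ i σ) = f σ)
    (c : ∀ n, K _⦋n⦌ → (Fin (n + 1) → ℚ) [⋀^Fin (p + 2)]→ₗ[ℚ] ℚ) (hc : IsNaturalCochain c)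
    (hcd : ∀ n σ, vertexD (c n σ) = 0) :
    ∃ b : ∀ n, K _⦋n⦌ → (Fin (n + 1) → ℚ) [⋀^Fin (p + 1)]→ₗ[ℚ] ℚ,
      IsNaturalCochain b ∧ ∀ n σ, vertexD (b n σ) = c n σ := by
  let f : K _⦋p + 1⦌ → ℚ := fun σ => c (p + 1) σ (fun l => Pi.single l 1)
  have hf : ∀ (n : ℕ) (θ : ⦋p + 1⦌ ⟶ ⦋n⦌) (τ : K _⦋n⦌), f (K.map θ.op τ) =
      c n τ (fun l => Pi.single (SimplexCategory.Hom.toOrderHom θ l) 1) := by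
    intro n θ τ
    change c (p + 1) (K.map θ.op τ) _ = _
    rw [hc (p + 1) n θ τ, AlternatingMap.compLinearMap_apply]
    exact congrArg _ (pushVertex_comp_single _ fun l => l)
  obtain ⟨g₀, hg₀⟩ := hK f (fun σ => by
    have h := vertexD_single (c (p + 2) σ) fun l => l
    rw [hcd] at h
    refine Eq.trans (Finset.sum_congr rfl fun i _ => ?_) h.symm
    exact congrArg _ (hf (p + 2) (SimplexCategory.δ i) σ))
  -- The coboundary of `g₀` is normalized, since `c` vanishes when a vertex is repeated; so `g₀` can
  -- be replaced by a normalized primitive.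
  obtain ⟨g, hgn, hg⟩ := K.exists_isNormalized p g₀ (by
    intro n θ hθ τ
    dsimp only
    rw [hg₀, hf]
    refine (c n τ).map_eq_zero_of_not_injective _ fun h => hθ ?_
    rw [SimplexCategory.mono_iff_injective]
    intro a a' ha
    exact h (by simp only [ha]))
  simp only [hg₀] at hg
  -- The alternating map takes on an increasing sequence of vertices the value of `g` on the face
  -- they span.
  have hex : ∀ (n : ℕ) (σ : K _⦋n⦌), ∃ F : (Fin (n + 1) → ℚ) [⋀^Fin (p + 1)]→ₗ[ℚ] ℚ,
      ∀ J : Fin (p + 1) → Fin (n + 1), ∀ hJ : StrictMono J,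
      F (fun l => Pi.single (J l) 1) =
        g (K.map (SimplexCategory.mkHom ⟨J, hJ.monotone⟩).op σ) := by
    classical
    intro n σ
    obtain ⟨F, hF⟩ := AlternatingMap.exists_apply_strictMono
      (fun J : Fin (p + 1) → Fin (n + 1) => if hJ : StrictMono J then
        g (K.map (SimplexCategory.mkHom ⟨J, hJ.monotone⟩).op σ) else 0)
    exact ⟨F, fun J hJ => by rw [hF J hJ, dif_pos hJ]⟩
  choose b hb using hex
  refine ⟨b, fun m n α σ => AlternatingMap.ext_strictMono fun J hJ => ?_,
    fun n σ => AlternatingMap.ext_strictMono fun J hJ => ?_⟩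
  · rw [hb m _ J hJ, AlternatingMap.compLinearMap_apply]
    have h1 : K.map (SimplexCategory.mkHom ⟨J, hJ.monotone⟩).op (K.map α.op σ) =
        K.map (SimplexCategory.mkHom ⟨J, hJ.monotone⟩ ≫ α).op σ := by
      rw [op_comp, K.map_comp]
      rfl
    rw [h1]
    have h2 := pushVertex_comp_single (SimplexCategory.Hom.toOrderHom α) J
    refine Eq.trans ?_ (congrArg (b n σ) h2).symm
    -- If vertices collide, one side vanishes because `g` is normalized and the other because a
    -- vector is repeated.
    by_cases hinj : Function.Injective fun l => SimplexCategory.Hom.toOrderHom α (J l)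
    · have hs : StrictMono fun l => SimplexCategory.Hom.toOrderHom α (J l) :=
        ((SimplexCategory.Hom.toOrderHom α).monotone.comp hJ.monotone).strictMono_of_injective hinj
      rw [hb n σ _ hs]
      rfl
    · rw [hgn n _ (by rw [SimplexCategory.mono_iff_injective]; exact hinj),
        (b n σ).map_eq_zero_of_not_injective]
      intro h
      exact hinj fun a a' ha => h (by simp only [ha])
  · rw [vertexD_single]
    have h1 := hf n (SimplexCategory.mkHom ⟨J, hJ.monotone⟩) σ
    refine Eq.trans ?_ h1
    rw [← hg]
    refine Finset.sum_congr rfl fun i _ => congrArg _ ?_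
    refine (hb n σ _ (hJ.comp i.strictMono_succAbove)).trans ?_
    have h2 : K.δ i (K.map (SimplexCategory.mkHom ⟨J, hJ.monotone⟩).op σ) =
        K.map (SimplexCategory.δ i ≫ SimplexCategory.mkHom ⟨J, hJ.monotone⟩).op σ := by
      rw [op_comp, K.map_comp]
      rfl
    rw [h2]
    rfl

/-! ### From singular cohomology to the minimal model. -/

theorem CochainComplex.exactAt_succ_iff (C : CochainComplex (ModuleCat.{u} ℚ) ℕ) (p : ℕ) :
    C.ExactAt (p + 1) ↔
      ∀ x : C.X (p + 1), C.d (p + 1) (p + 2) x = 0 → ∃ y : C.X p, C.d p (p + 1) y = x := by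
  rw [HomologicalComplex.exactAt_iff' C p (p + 1) (p + 2) (by simp) (by simp),
    ShortComplex.moduleCat_exact_iff]
  rfl

theorem singularCochains_d_apply (X : TopCat.{u}) (p : ℕ)
    (f : (TopCat.toSSet.obj X) _⦋p⦌ → ℚ) (σ : (TopCat.toSSet.obj X) _⦋p + 1⦌) :
    (show (TopCat.toSSet.obj X) _⦋p + 1⦌ → ℚ from (singularCochains X).d p (p + 1) f) σ =
      ∑ i : Fin (p + 2), (-1 : ℚ) ^ (i : ℕ) * f ((TopCat.toSSet.obj X).δ i σ) := by
  have h : (singularCochains X).d p (p + 1) =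
      AlgebraicTopology.AlternatingCofaceMapComplex.objD (ratCosimplicial (TopCat.toSSet.obj X)) p :=
    CochainComplex.of_d (fun q => (ratCosimplicial (TopCat.toSSet.obj X)).obj ⦋q⦌)
      (AlgebraicTopology.AlternatingCofaceMapComplex.objD
        (ratCosimplicial (TopCat.toSSet.obj X))) p
  let D : ((TopCat.toSSet.obj X) _⦋p⦌ → ℚ) →ₗ[ℚ] ((TopCat.toSSet.obj X) _⦋p + 1⦌ → ℚ) :=
    (AlgebraicTopology.AlternatingCofaceMapComplex.objD
      (ratCosimplicial (TopCat.toSSet.obj X)) p).hom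
  have hD : D = ∑ i : Fin (p + 2), (-1 : ℤ) ^ (i : ℕ) •
      LinearMap.funLeft ℚ ℚ ((TopCat.toSSet.obj X).δ i) := by
    simp only [D, AlgebraicTopology.AlternatingCofaceMapComplex.objD, ModuleCat.hom_sum,
      ModuleCat.hom_zsmul]
    rfl
  rw [h]
  change D f σ = _
  rw [hD]
  simp [LinearMap.sum_apply, LinearMap.funLeft_apply]

/-- The algebra of polynomial forms of a space is exact where the rational cohomology vanishes. -/
theorem APL.exactAt (X : TopCat.{u}) (p : ℕ) (hX : (singularCochains X).ExactAt (p + 1)) :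
    (APL X).ExactAt (p + 1) := by
  rw [CochainComplex.exactAt_succ_iff] at hX ⊢
  have hd : ∀ q, (APL X).d q (q + 1) = ModuleCat.ofHom ((TopCat.toSSet.obj X).polyFormsD q) :=
    CochainComplex.of_d (fun q => ModuleCat.of ℚ ((TopCat.toSSet.obj X).polyForms q))
      fun q => ModuleCat.ofHom ((TopCat.toSSet.obj X).polyFormsD q)
  intro Φ hΦ
  rw [hd] at hΦ
  obtain ⟨Ψ, hΨ⟩ := (TopCat.toSSet.obj X).exists_polyFormsD_eq p
    ((TopCat.toSSet.obj X).exists_isNaturalCochain p fun f hf => by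
      obtain ⟨g, hg⟩ := hX f (funext fun σ => (singularCochains_d_apply X (p + 1) f σ).trans (hf σ))
      exact ⟨g, fun σ => (singularCochains_d_apply X p g σ).symm.trans (congrFun hg σ)⟩) Φ hΦ
  exact ⟨Ψ, by rw [hd]; exact hΨ⟩

theorem MinimalSullivanAlgebra.exists_d_eq {V : ℕ → Type u} [∀ k, AddCommGroup (V k)]
    [∀ k, Module ℚ (V k)] (A : MinimalSullivanAlgebra V) {k : ℕ} (h : A.complex.ExactAt (k + 1))
    {a : FreeGC V} (ha : a ∈ FreeGC.gr V (k + 1)) (hd : A.d a = 0) :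
    ∃ w ∈ FreeGC.gr V k, A.d w = a := by
  have hD : ∀ q, A.complex.d q (q + 1) = ModuleCat.ofHom (A.d.restrict (A.d_mem q)) :=
    CochainComplex.of_d (fun q => ModuleCat.of ℚ (FreeGC.gr V q))
      fun q => ModuleCat.ofHom (A.d.restrict (A.d_mem q))
  rw [CochainComplex.exactAt_succ_iff] at h
  obtain ⟨w, hw⟩ := h (A.toComplex a ha) (by rw [hD]; exact Subtype.ext hd)
  rw [hD] at hw
  exact ⟨(show FreeGC.gr V k from w).1, (show FreeGC.gr V k from w).2, congrArg Subtype.val hw⟩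

end

theorem mainTheorem2 (X : TopCat.{u}) [SimplyConnectedSpace X] (N : ℕ)
    (hfin : Module.Finite ℚ (⨁ k, ratCohomology X k))
    (hN : IsGreatest {k | Nontrivial (ratCohomology X k)} N)
    (V : ℕ → Type u) [∀ k, AddCommGroup (V k)] [∀ k, Module ℚ (V k)]
    (A : MinimalSullivanAlgebra V) (φ : A.complex ⟶ APL X) (hφ : A.IsModel X φ)
    (n : ℕ) (x : V (2 * n + 1)) (hx : A.IsGottlieb x)
    (ι : ℕ → Type*) (b : ∀ k, Module.Basis (ι k) ℚ (V k))
    (hmon : FreeGC.IsMonomial V b (A.d (FreeGC.gen V (2 * n + 1) x))) :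
    2 * n + 1 < 2 * N := by
  refine A.degree_lt_of_isGottlieb b hx hmon fun k hk a ha hd => A.exists_d_eq ?_ ha hd
  have := hφ.quasiIso
  have h1 : (singularCochains X).ExactAt (k + 1) := by
    rw [HomologicalComplex.exactAt_iff_isZero_homology]
    have : Subsingleton ((singularCochains X).homology (k + 1)) := by
      by_contra h
      have := hN.2 (not_subsingleton_iff_nontrivial.1 h)
      omega
    exact ModuleCat.isZero_of_subsingleton _
  -- Exactness passes from singular cochains to $A_{PL}(X)$, and then back along the
  -- quasi-isomorphism to the model.
  exact (quasiIsoAt_iff_exactAt' φ (k + 1) (APL.exactAt X k h1)).1 inferInstance
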